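/- For integers $m,n\ge 1$ let $K^m_n$ be the loopless multigraph on $[n]=\{1,\dots,n\}$ having, for every $1\le i<j\le n$, exactly $m$ edges between $j$ and $i$, written $ji^{(a)}$ and labelled $a=1,\dots,m$. The uniform attachment graph $G^m_n$ is the random subgraph of $K^m_n$ with vertex set $[n]$ obtained by choosing, for every $j\in\{2,\dots,n\}$ and every $a\in[m]$, exactly one of the edges $ji^{(a)}$, $i\in[j-1]$, uniformly at random, all choices being independent. A copy of a graph $H$ in a multigraph $G$ is a subgraph of $G$ isomorphic to $H$ (parallel edges are distinguished). A potential copy of $H$ in $G^m_n$ is a copy of $H$ in $K^m_n$ that does not contain two different edges $ji_1^{(a)}$, $ji_2^{(a)}$ with $i_1,i_2<j$ and the same label $a$. Let $m_H$ be the least integer $m\ge 1$ such that for some $n$ there is a potential copy of $H$ in $G^m_n$. Theorem 3.7. Let $H$ be a finite connected loopless multigraph that is multicyclic, i.e. contains at least two different (not necessarily edge- or vertex-disjoint) cycles, where a pair of parallel edges counts as a cycle of length $2$. Let $H'$ be the $2$-core of $H$, i.e. the largest subgraph of $H$ in which every vertex has degree at least $2$, so that $H$ is obtained from $H'$ by attaching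 trees, and let $t\ge 0$ be the number of vertices of $H$ outside $H'$ (equivalently, the total number of edges of the attached trees). Let $m\ge m_H$ be a positive integer, and let $W_n$ be the number of copies of $H$ in $G^m_n$. Then, as $n\to\infty$ with $H$ and $m$ fixed, $$\mathbb{E}\, W_n=\Theta\bigl(\log^{t} n\bigr),\qquad \operatorname{Var}(W_n)=O\bigl(\log^{2t} n\bigr).$$ -/

import Mathlib

open scoped Graph

namespace UniformAttachment

open MeasureTheory ProbabilityTheory

/-! ### Multigraphs

Graphs are Mathlib's multigraphs `Graph α β`, with vertices in `α` and edges in `β`; a subgraph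
relation `K ≤ G` means `V(K) ⊆ V(G)`, and every edge of `K` is an edge of `G` with the same ends. -/

section Multigraph

variable {α β α' β' : Type*}

/-- The degree of a vertex: the number of incident edges, where a loop counts twice. -/
noncomputable def degree (G : Graph α β) (v : α) : ℕ∞ :=
  (G.incidenceSet v).encard + (G.loopSet v).encard

/-- A multigraph is connected if it has a vertex and any two of its vertices are joined by a
walk. -/
def IsConnected (G : Graph α β) : Prop :=
  V(G).Nonempty ∧ ∀ x ∈ V(G), ∀ y ∈ V(G), Relation.ReflTransGen G.Adj x y

/-- A cycle: a finite connected multigraph in which every vertex has degree `2`. In particular a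
pair of parallel edges is a cycle (of length `2`). -/
def IsCycle (C : Graph α β) : Prop :=
  V(C).Finite ∧ IsConnected C ∧ ∀ v ∈ V(C), degree C v = 2

/-- A multigraph is multicyclic if it contains at least two different cycles, which need not be
edge- or vertex-disjoint. -/
def IsMulticyclic (G : Graph α β) : Prop :=
  ∃ C₁ C₂ : Graph α β, C₁ ≤ G ∧ C₂ ≤ G ∧ IsCycle C₁ ∧ IsCycle C₂ ∧ C₁ ≠ C₂

/-- Every vertex has degree at least `2`. -/
def MinDegreeTwo (G : Graph α β) : Prop :=
  ∀ v ∈ V(G), 2 ≤ degree G v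

/-- The `2`-core of `G`: the largest subgraph of `G` in which every vertex has degree at least `2`,
namely the union of all such subgraphs (see `isGreatest_twoCore`). -/
def twoCore (G : Graph α β) : Graph α β where
  vertexSet := {v | ∃ K ≤ G, MinDegreeTwo K ∧ v ∈ V(K)}
  IsLink e x y := ∃ K ≤ G, MinDegreeTwo K ∧ K.IsLink e x y
  isLink_symm _ _ := ⟨fun _ _ ⟨K, hK, h, hl⟩ => ⟨K, hK, h, hl.symm⟩⟩
  eq_or_eq_of_isLink_of_isLink := by
    rintro e x y v w ⟨K, hK, -, hl⟩ ⟨L, hL, -, hl'⟩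
    exact (hK.isLink_mono hl).left_eq_or_eq (hL.isLink_mono hl')
  left_mem_of_isLink := by
    rintro e x y ⟨K, hK, h, hl⟩
    exact ⟨K, hK, h, hl.left_mem⟩

lemma isGreatest_twoCore (G : Graph α β) :
    IsGreatest {K | K ≤ G ∧ MinDegreeTwo K} (twoCore G) := by
  have key : ∀ K, K ≤ G → MinDegreeTwo K → K ≤ twoCore G := fun K hK h =>
    ⟨fun v hv => ⟨K, hK, h, hv⟩, fun e x y hl => ⟨K, hK, h, hl⟩⟩
  refine ⟨⟨⟨?_, ?_⟩, ?_⟩, fun K hK => key K hK.1 hK.2⟩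
  · rintro v ⟨K, hK, -, hv⟩
    exact hK.vertexSet_mono hv
  · rintro e x y ⟨K, hK, -, hl⟩
    exact hK.isLink_mono hl
  · rintro v ⟨K, hK, h, hv⟩
    refine (h v hv).trans (add_le_add (Set.encard_le_encard ?_) (Set.encard_le_encard ?_))
    · rintro e ⟨y, hy⟩
      exact ⟨y, (key K hK h).isLink_mono hy⟩
    · intro e he
      exact (key K hK h).isLink_mono he

/-- Two multigraphs are isomorphic: there are bijections between their vertices and between their
edges that preserve incidence. -/
def Isomorphic (G : Graph α β) (H : Graph α' β') : Prop :=
  ∃ (f : V(G) ≃ V(H)) (g : E(G) ≃ E(H)), ∀ (e : E(G)) (x y : V(G)),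
    G.IsLink (e : β) (x : α) (y : α) ↔ H.IsLink (g e : β') (f x : α') (f y : α')

/-- The copies of `H` in `G`: the subgraphs of `G` that are isomorphic to `H`. -/
def copies (H : Graph α β) (G : Graph α' β') : Set (Graph α' β') :=
  {K | K ≤ G ∧ Isomorphic K H}

end Multigraph

/-! ### The uniform attachment graph -/

/-- The `m`-fold complete multigraph `K^m_n` on `{1, …, n}`. For `1 ≤ i < j ≤ n` and each of the `m`
labels `a`, the triple `(j, i, a)` is an edge joining `j` to `i`. -/
def completeMultigraph (m n : ℕ) : Graph ℕ (ℕ × ℕ × Fin m) where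
  vertexSet := Set.Icc 1 n
  IsLink e x y := (1 ≤ e.2.1 ∧ e.2.1 < e.1 ∧ e.1 ≤ n) ∧
    ((x = e.1 ∧ y = e.2.1) ∨ (x = e.2.1 ∧ y = e.1))
  isLink_symm _ _ := ⟨fun _ _ h => ⟨h.1, h.2.symm.imp And.symm And.symm⟩⟩
  eq_or_eq_of_isLink_of_isLink := by grind
  left_mem_of_isLink := by
    rintro e x y ⟨h, h'⟩
    simp only [Set.mem_Icc]
    omega

/-- The outcomes of all the choices: each vertex `j ∈ {2, …, n}` chooses, for each label `a`, a
vertex in `{1, …, j - 1}`. -/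
abbrev Choices (m n : ℕ) : Type :=
  (p : Finset.Icc 2 n × Fin m) → Finset.Icc 1 ((p.1 : ℕ) - 1)

/-- All choices are uniformly random and independent. -/
noncomputable def choiceMeasure (m n : ℕ) : Measure (Choices m n) :=
  Measure.pi fun _ => uniformOn Set.univ

/-- The uniform attachment graph `G^m_n`: the subgraph of `K^m_n` on all `n` vertices whose edges
are the edges `(j, i, a)` for which `j` has chosen `i` for the label `a`. -/
def attachmentGraph (m n : ℕ) (ω : Choices m n) : Graph ℕ (ℕ × ℕ × Fin m) :=
  (completeMultigraph m n).restrict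
    {e | ∃ h : e.1 ∈ Finset.Icc 2 n, (ω (⟨e.1, h⟩, e.2.2) : ℕ) = e.2.1}

variable {α β : Type*}

/-- The number `W_n` of copies of `H` in `G^m_n`, a random variable. -/
noncomputable def copyCount (H : Graph α β) (m n : ℕ) (ω : Choices m n) : ℝ :=
  (copies H (attachmentGraph m n ω)).ncard

/-- The potential copies of `H` in `G^m_n`: the copies of `H` in `K^m_n` that do not contain two
different edges from the same vertex to smaller vertices with the same label. -/
def potentialCopies (H : Graph α β) (m n : ℕ) : Set (Graph ℕ (ℕ × ℕ × Fin m)) :=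
  {K ∈ copies H (completeMultigraph m n) |
    ∀ e ∈ E(K), ∀ f ∈ E(K), e.1 = f.1 → e.2.2 = f.2.2 → e = f}

/-- `m_H`: the least `m ≥ 1` such that for some `n` there is a potential copy of `H` in `G^m_n`. -/
noncomputable def minLabels (H : Graph α β) : ℕ :=
  sInf {m | 1 ≤ m ∧ ∃ n, (potentialCopies H m n).Nonempty}

end UniformAttachment

/-!
A copy of `H` is contained in `G^m_n` with probability `∏ 1 / (j - 1)` over its edges `(j, i, a)`,
unless two of its edges compete for the same choice. When `H` is connected and multicyclic, Hall's
theorem matches every vertex of `H` to an incident edge, with a second edge for any one prescribed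
vertex of the `2`-core. As an edge contributes at most `1 / (v - 1)` for either of its ends `v`, a
copy has weight `O(∏ 1 / v)`, with an additional factor `1 / max` over its core vertices. Spreading
this factor evenly turns the exponent `-1` of a core vertex into `-(1 + ε)`, so summing over
positions gives a convergent product for the core and `log n` for each other vertex. The union of
two copies expands in the same way with respect to the union of their cores, and this bounds the
second moment. For the lower bound, the trees are built leaf by leaf: a copy of `H - v` in `K^m_N`
can be extended by a leaf at any of the positions in `(N, Nb]`, which multiplies the expectation by
at least `log b`.
-/

namespace UniformAttachment

open MeasureTheory ProbabilityTheory

section Expansion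

variable {α β : Type*} {G H K L : Graph α β} {S S' : Set α} {T : Set β} {e : β} {v : α}

/-- The edges incident with at least one vertex of `S`. -/
def touching (G : Graph α β) (S : Set α) : Set β := {e | ∃ v ∈ S, G.Inc e v}

lemma touching_subset_edgeSet : touching G S ⊆ E(G) := by
  rintro e ⟨v, -, h⟩
  exact h.edge_mem

lemma touching_mono (h : S ⊆ S') : touching G S ⊆ touching G S' :=
  fun _ ⟨v, hv, he⟩ => ⟨v, h hv, he⟩

lemma touching_vertexSet : touching G V(G) = E(G) := by
  refine touching_subset_edgeSet.antisymm fun e he => ?_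
  obtain ⟨x, y, h⟩ := Graph.exists_isLink_of_mem_edgeSet he
  exact ⟨x, h.left_mem, h.inc_left⟩

/-- No vertex of `S` is an end of exactly one edge of `F`. This is the property of edge sets of
subgraphs of minimum degree two, and of symmetric differences of cycles, which a forest excludes. -/
def IsLeafless (G : Graph α β) (S : Set α) (F : Set β) : Prop :=
  ∀ v ∈ S, ∀ e ∈ F, G.Inc e v → ∃ e' ∈ F, e' ≠ e ∧ G.Inc e' v

lemma exists_isLink_of_ssubset (hconn : IsConnected G) (hne : S.Nonempty) (hS : S ⊂ V(G)) :
    ∃ e, ∃ s ∈ S, ∃ u ∉ S, G.IsLink e s u := by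
  obtain ⟨x, hx⟩ := hne
  obtain ⟨y, hy, hyS⟩ := Set.exists_of_ssubset hS
  by_contra! hclosed
  have hreach : ∀ z, Relation.ReflTransGen G.Adj x z → z ∈ S := by
    intro z hz
    induction hz with
    | refl => exact hx
    | tail _ hadj ih =>
      obtain ⟨e, he⟩ := hadj
      by_contra hc
      exact hclosed e _ ih _ hc he
  exact hyS (hreach y (hconn.2 x (hS.1 hx) y hy))

/-- A set `T` of edges touching `S` which is a forest in which every component has exactly one
vertex outside `S`; acyclicity is expressed by the absence of leafless subsets. -/
structure IsRootedForest (G : Graph α β) (S : Set α) (T : Set β) : Prop where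
  subset_touching : T ⊆ touching G S
  encard_eq : T.encard = S.encard
  eq_empty_of_isLeafless : ∀ F ⊆ T, IsLeafless G S F → F = ∅

lemma IsRootedForest.insert {s u : α} (h : IsRootedForest G (S \ {s}) T) (hs : s ∈ S) (hu : u ∉ S)
    (he : G.IsLink e s u) : IsRootedForest G S (insert e T) := by
  have he_notInc : ∀ v ∈ S \ {s}, ¬ G.Inc e v := by
    rintro v ⟨hv, hvs⟩ hinc
    rcases hinc.eq_or_eq_of_isLink he with rfl | rfl
    exacts [hvs rfl, hu hv]
  have heT : e ∉ T := fun heT =>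
    have ⟨v, hv, hinc⟩ := h.subset_touching heT
    he_notInc v hv hinc
  refine ⟨Set.insert_subset ⟨s, hs, he.inc_left⟩
    (h.subset_touching.trans (touching_mono Set.sdiff_subset)), ?_, fun F hF hleaf => ?_⟩
  · rw [Set.encard_insert_of_notMem heT, h.encard_eq, Set.encard_sdiff_singleton_add_one hs]
  have hFe : F ⊆ {e} := by
    refine Set.sdiff_eq_empty.1 (h.eq_empty_of_isLeafless _ (by simpa using hF) ?_)
    intro v hv f hf hinc
    obtain ⟨f', hf', hne, hinc'⟩ := hleaf v hv.1 f hf.1 hinc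
    exact ⟨f', ⟨hf', fun h => he_notInc v hv (h ▸ hinc')⟩, hne, hinc'⟩
  refine Set.eq_empty_of_forall_notMem fun f hf => ?_
  obtain rfl : f = e := hFe hf
  obtain ⟨f', hf', hne, -⟩ := hleaf s hs f hf he.inc_left
  exact hne (hFe hf')

lemma exists_isRootedForest (hconn : IsConnected G) (hfin : S.Finite) (hS : S ⊂ V(G)) :
    ∃ T, IsRootedForest G S T := by
  induction hn : S.ncard generalizing S with
  | zero =>
    obtain rfl := (Set.ncard_eq_zero hfin).1 hn
    exact ⟨∅, Set.empty_subset _, by simp, fun _ h _ => Set.subset_empty_iff.1 h⟩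
  | succ n ih =>
    obtain ⟨e, s, hs, u, hu, he⟩ := exists_isLink_of_ssubset hconn
      (Set.nonempty_of_ncard_ne_zero (by omega)) hS
    obtain ⟨T, hT⟩ := ih (S := S \ {s}) hfin.sdiff (Set.sdiff_subset.trans_ssubset hS)
      (by rw [Set.ncard_sdiff_singleton_of_mem hs, hn, Nat.add_sub_cancel])
    exact ⟨_, hT.insert hs hu he⟩

lemma degree_eq_encard [G.Loopless] (v : α) : degree G v = (G.incidenceSet v).encard := by
  have hloops : G.loopSet v = ∅ := by
    ext e
    simp
  rw [degree, hloops, Set.encard_empty, add_zero]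

lemma MinDegreeTwo.exists_inc_ne [K.Loopless] (h : MinDegreeTwo K) (hv : v ∈ V(K)) (e : β) :
    ∃ e', e' ≠ e ∧ K.Inc e' v := by
  have hdeg := h v hv
  rw [degree_eq_encard] at hdeg
  obtain ⟨e', he', hne⟩ :=
    Set.exists_ne_of_one_lt_encard (lt_of_lt_of_le (by norm_num) hdeg) e
  exact ⟨e', hne, he'⟩

lemma MinDegreeTwo.exists_inc [K.Loopless] (h : MinDegreeTwo K) (hv : v ∈ V(K)) :
    ∃ e, K.Inc e v := by
  have hdeg := h v hv
  rw [degree_eq_encard] at hdeg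
  have hne : (K.incidenceSet v).Nonempty := Set.encard_pos.1 (lt_of_lt_of_le (by norm_num) hdeg)
  exact hne

lemma MinDegreeTwo.isLeafless [G.Loopless] (h : MinDegreeTwo K) (hK : K ≤ G) (S : Set α) :
    IsLeafless G S E(K) := by
  have : K.Loopless := Graph.Loopless.anti hK
  intro v _ e he hinc
  obtain ⟨e', hne, hinc'⟩ := h.exists_inc_ne ((hK.inc_congr he).2 hinc).vertex_mem e
  exact ⟨e', hinc'.edge_mem, hne, hinc'.mono hK⟩

lemma MinDegreeTwo.vertexSet_subset_of_edgeSet_subset [G.Loopless] (h : MinDegreeTwo K)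
    (hK : K ≤ G) (hL : L ≤ G) (hE : E(K) ⊆ E(L)) : V(K) ⊆ V(L) := by
  have : K.Loopless := Graph.Loopless.anti hK
  intro v hv
  obtain ⟨e, he⟩ := h.exists_inc hv
  exact ((hL.inc_congr (hE he.edge_mem)).2 (he.mono hK)).vertex_mem

lemma MinDegreeTwo.eq_of_edgeSet_eq [G.Loopless] (hK' : MinDegreeTwo K) (hL' : MinDegreeTwo L)
    (hK : K ≤ G) (hL : L ≤ G) (hE : E(K) = E(L)) : K = L :=
  Graph.Compatible.ext ((hK'.vertexSet_subset_of_edgeSet_subset hK hL hE.le).antisymm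
    (hL'.vertexSet_subset_of_edgeSet_subset hL hK hE.ge)) hE (Graph.Compatible.of_le_le hK hL)

lemma IsCycle.minDegreeTwo (h : IsCycle K) : MinDegreeTwo K := fun v hv => (h.2.2 v hv).ge

lemma IsCycle.exists_mem_symmDiff_ne [G.Loopless] (hK : K ≤ G) (hL : L ≤ G) (hcK : IsCycle K)
    (hcL : IsCycle L) (he : e ∈ E(K) \ E(L)) (hinc : G.Inc e v) :
    ∃ e' ∈ symmDiff E(K) E(L), e' ≠ e ∧ G.Inc e' v := by
  have : K.Loopless := Graph.Loopless.anti hK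
  obtain ⟨e₁, he₁K, hne₁, hinc₁⟩ := hcK.minDegreeTwo.isLeafless hK _ v (Set.mem_univ v) e he.1 hinc
  by_cases he₁L : e₁ ∈ E(L)
  · obtain ⟨e₂, he₂L, hne₂, hinc₂⟩ :=
      hcL.minDegreeTwo.isLeafless hL _ v (Set.mem_univ v) e₁ he₁L hinc₁
    have hne₃ : e₂ ≠ e := fun h => he.2 (h ▸ he₂L)
    refine ⟨e₂, Or.inr ⟨he₂L, fun he₂K => ?_⟩, hne₃, hinc₂⟩
    have hsub : ({e, e₁, e₂} : Set β) ⊆ K.incidenceSet v := by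
      rintro x (rfl | rfl | rfl)
      exacts [(hK.inc_congr he.1).2 hinc, (hK.inc_congr he₁K).2 hinc₁, (hK.inc_congr he₂K).2 hinc₂]
    have hthree := Set.encard_le_encard hsub
    rw [← degree_eq_encard, hcK.2.2 v ((hK.inc_congr he.1).2 hinc).vertex_mem,
      Set.encard_eq_three.2 ⟨e, e₁, e₂, hne₁.symm, hne₃.symm, hne₂.symm, rfl⟩] at hthree
    exact absurd hthree (by norm_num)
  · exact ⟨e₁, Or.inl ⟨he₁K, he₁L⟩, hne₁, hinc₁⟩

lemma IsCycle.isLeafless_symmDiff [G.Loopless] (hcK : IsCycle K) (hcL : IsCycle L) (hK : K ≤ G)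
    (hL : L ≤ G) (S : Set α) : IsLeafless G S (symmDiff E(K) E(L)) := by
  rintro v - e (he | he) hinc
  · exact exists_mem_symmDiff_ne hK hL hcK hcL he hinc
  · rw [symmDiff_comm]
    exact exists_mem_symmDiff_ne hL hK hcL hcK he hinc

lemma IsMulticyclic.encard_vertexSet_lt_encard_edgeSet [H.Loopless] (hmulti : IsMulticyclic H)
    (hconn : IsConnected H) (hV : V(H).Finite) : V(H).encard + 1 ≤ E(H).encard := by
  obtain ⟨C₁, C₂, h₁, h₂, hC₁, hC₂, hne⟩ := hmulti
  obtain ⟨r, hr⟩ := hconn.1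
  obtain ⟨T, hT⟩ := exists_isRootedForest hconn (S := V(H) \ {r}) hV.sdiff
    ⟨Set.sdiff_subset, fun h => (h hr).2 rfl⟩
  by_contra! hcard
  have hTE : T ⊆ E(H) := hT.subset_touching.trans touching_subset_edgeSet
  have hrest : (E(H) \ T).Subsingleton := by
    rw [← Set.encard_le_one_iff_subsingleton]
    have hTfin : T.encard ≠ ⊤ := by
      rw [hT.encard_eq]
      exact hV.sdiff.encard_lt_top.ne
    rw [← Set.encard_sdiff_singleton_add_one hr, ← hT.encard_eq,
      ← Set.encard_sdiff_add_encard_of_subset hTE, add_assoc, one_add_one_eq_two,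
      add_comm, ENat.add_lt_add_iff_left hTfin] at hcard
    exact Order.le_of_lt_add_one (hcard.trans_eq one_add_one_eq_two.symm)
  have exists_notMem : ∀ C ≤ H, IsCycle C → ∃ g ∈ E(C), g ∉ T := by
    intro C hCH hC
    have : C.Loopless := Graph.Loopless.anti hCH
    by_contra! hCT
    obtain ⟨v, hv⟩ := hC.2.1.1
    obtain ⟨e, he⟩ := hC.minDegreeTwo.exists_inc hv
    exact (hT.eq_empty_of_isLeafless _ hCT (hC.minDegreeTwo.isLeafless hCH _)).subset he.edge_mem
  obtain ⟨g₁, hg₁, hg₁T⟩ := exists_notMem C₁ h₁ hC₁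
  obtain ⟨g₂, hg₂, hg₂T⟩ := exists_notMem C₂ h₂ hC₂
  obtain rfl := hrest ⟨h₁.edgeSet_mono hg₁, hg₁T⟩ ⟨h₂.edgeSet_mono hg₂, hg₂T⟩
  have hsymmDiff : symmDiff E(C₁) E(C₂) ⊆ T := by
    rintro e (he | he) <;> by_contra heT
    · exact he.2 (hrest ⟨h₁.edgeSet_mono hg₁, hg₁T⟩ ⟨h₁.edgeSet_mono he.1, heT⟩ ▸ hg₂)
    · exact he.2 (hrest ⟨h₁.edgeSet_mono hg₁, hg₁T⟩ ⟨h₂.edgeSet_mono he.1, heT⟩ ▸ hg₁)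
  exact hne <| hC₁.minDegreeTwo.eq_of_edgeSet_eq hC₂.minDegreeTwo h₁ h₂ <| symmDiff_eq_bot.1 <|
    hT.eq_empty_of_isLeafless _ hsymmDiff (hC₁.isLeafless_symmDiff hC₂ h₁ h₂ _)

lemma twoCore_le (G : Graph α β) : twoCore G ≤ G := (isGreatest_twoCore G).1.1

lemma minDegreeTwo_twoCore (G : Graph α β) : MinDegreeTwo (twoCore G) := (isGreatest_twoCore G).1.2

lemma MinDegreeTwo.le_twoCore (h : MinDegreeTwo K) (hK : K ≤ G) : K ≤ twoCore G :=
  (isGreatest_twoCore G).2 ⟨hK, h⟩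

lemma IsMulticyclic.vertexSet_twoCore_nonempty (h : IsMulticyclic G) : V(twoCore G).Nonempty := by
  obtain ⟨C, -, hC, -, hcycle, -⟩ := h
  exact hcycle.2.1.1.mono (hcycle.minDegreeTwo.le_twoCore hC).vertexSet_mono

lemma encard_lt_encard_touching_of_inter_twoCore [H.Loopless] (hconn : IsConnected H)
    (hfin : S.Finite) (hS : S ⊂ V(H)) (hcore : (S ∩ V(twoCore H)).Nonempty) :
    S.encard + 1 ≤ (touching H S).encard := by
  have : (twoCore H).Loopless := Graph.Loopless.anti (twoCore_le H)
  obtain ⟨T, hT⟩ := exists_isRootedForest hconn hfin hS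
  refine Order.add_one_le_of_lt (lt_of_le_of_ne
    (hT.encard_eq ▸ Set.encard_le_encard hT.subset_touching) fun hcard => ?_)
  have hTS : T = touching H S := by
    refine Set.Finite.eq_of_subset_of_encard_le ?_ hT.subset_touching (hcard ▸ hT.encard_eq.ge)
    rw [← Set.encard_lt_top_iff, hT.encard_eq]
    exact hfin.encard_lt_top
  obtain ⟨v, hvS, hv⟩ := hcore
  obtain ⟨e, he⟩ := (minDegreeTwo_twoCore H).exists_inc hv
  have hempty : touching H S ∩ E(twoCore H) = ∅ := by
    refine hT.eq_empty_of_isLeafless _ (hTS ▸ Set.inter_subset_left) fun w hw f hf hinc => ?_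
    obtain ⟨f', hf', hne, hinc'⟩ :=
      (minDegreeTwo_twoCore H).isLeafless (twoCore_le H) S w hw f hf.2 hinc
    exact ⟨f', ⟨⟨w, hw, hinc'⟩, hf'⟩, hne, hinc'⟩
  exact hempty.subset ⟨⟨v, hvS, he.mono (twoCore_le H)⟩, he.edge_mem⟩

/-- Hall's condition for matching the vertices of `G` to incident edges, with one edge to spare for
every vertex set that meets `D`. -/
def Expands (G : Graph α β) (D : Set α) : Prop :=
  ∀ S ⊆ V(G), S.encard ≤ (touching G S).encard ∧
    ((S ∩ D).Nonempty → S.encard + 1 ≤ (touching G S).encard)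

lemma IsMulticyclic.expands_twoCore [H.Loopless] (hmulti : IsMulticyclic H)
    (hconn : IsConnected H) (hV : V(H).Finite) : Expands H V(twoCore H) := by
  intro S hS
  rcases hS.eq_or_ssubset with rfl | hssub
  · have hcard := hmulti.encard_vertexSet_lt_encard_edgeSet hconn hV
    rw [touching_vertexSet]
    exact ⟨le_self_add.trans hcard, fun _ => hcard⟩
  · obtain ⟨T, hT⟩ := exists_isRootedForest hconn (hV.subset hS) hssub
    exact ⟨hT.encard_eq ▸ Set.encard_le_encard hT.subset_touching,
      encard_lt_encard_touching_of_inter_twoCore hconn (hV.subset hS) hssub⟩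

end Expansion

section Subgraph

variable {α β : Type*} {G G' K L J : Graph α β} {X D D' : Set α} {F : Set β}

/-- The subgraph of `G` with vertex set `X` whose edges are those in `F` with both ends in `X`. -/
def subgraphOn (G : Graph α β) (X : Set α) (F : Set β) : Graph α β := (G.restrict F).induce X

lemma le_subgraphOn (hK : K ≤ G) (hX : V(K) ⊆ X) (hF : E(K) ⊆ F) : K ≤ subgraphOn G X F :=
  ⟨hX, fun _ _ _ h => ⟨⟨hF h.edge_mem, hK.isLink_mono h⟩, hX h.left_mem, hX h.right_mem⟩⟩

lemma subgraphOn_le (hG : G' ≤ G) (hX : X ⊆ V(G')) (hF : F ⊆ E(G')) : subgraphOn G X F ≤ G' :=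
  ⟨hX, fun _ _ _ h => (hG.isLink_iff (hF h.1.1)).2 h.1.2⟩

lemma edgeSet_subgraphOn (hF : ∀ e ∈ F, ∃ x ∈ X, ∃ y ∈ X, G.IsLink e x y) :
    E(subgraphOn G X F) = F := by
  ext e
  refine ⟨fun ⟨_, _, h⟩ => h.1.1, fun he => ?_⟩
  obtain ⟨x, hx, y, hy, h⟩ := hF e he
  exact ⟨x, y, ⟨he, h⟩, hx, hy⟩

lemma injOn_vertexSet_edgeSet (G : Graph α β) :
    Set.InjOn (fun K : Graph α β => (V(K), E(K))) {K | K ≤ G} := fun _ hK _ hL h =>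
  Graph.Compatible.ext (congrArg Prod.fst h) (congrArg Prod.snd h) (Graph.Compatible.of_le_le hK hL)

lemma mapsTo_vertexSet_edgeSet (G : Graph α β) :
    Set.MapsTo (fun K : Graph α β => (V(K), E(K))) {K | K ≤ G} (𝒫 V(G) ×ˢ 𝒫 E(G)) :=
  fun _ hK => ⟨hK.vertexSet_mono, hK.edgeSet_mono⟩

lemma finite_setOf_le (hV : V(G).Finite) (hE : E(G).Finite) : {K | K ≤ G}.Finite :=
  Set.Finite.of_injOn (mapsTo_vertexSet_edgeSet G) (injOn_vertexSet_edgeSet G)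
    (hV.powerset.prod hE.powerset)

lemma ncard_setOf_le_le (hV : V(G).Finite) (hE : E(G).Finite) :
    {K | K ≤ G}.ncard ≤ 2 ^ V(G).ncard * 2 ^ E(G).ncard := by
  rw [← Set.ncard_powerset _ hV, ← Set.ncard_powerset _ hE, ← Set.ncard_prod]
  exact Set.ncard_le_ncard_of_injOn _ (mapsTo_vertexSet_edgeSet G) (injOn_vertexSet_edgeSet G)
    (hV.powerset.prod hE.powerset)

lemma touching_mono_left (h : K ≤ J) (S : Set α) : touching K S ⊆ touching J S :=
  fun _ ⟨v, hv, he⟩ => ⟨v, hv, he.mono h⟩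

lemma Expands.union_left (hKD : Expands K D) (hLD : Expands L D') (hD : D ⊆ V(K)) (hK : K ≤ J)
    (hL : L ≤ J) (hV : V(J) ⊆ V(K) ∪ V(L)) : Expands J D := by
  intro S hS
  have hdisj : Disjoint (touching K (S ∩ V(K))) (touching L (S \ V(K))) := by
    rw [Set.disjoint_left]
    rintro e ⟨v, -, hv⟩ ⟨w, hw, hw'⟩
    exact hw.2 ((hK.inc_congr hv.edge_mem).2 (hw'.mono hL)).vertex_mem
  have htouching : (touching K (S ∩ V(K))).encard + (touching L (S \ V(K))).encard ≤
      (touching J S).encard := by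
    rw [← Set.encard_union_eq hdisj]
    exact Set.encard_le_encard (Set.union_subset
      ((touching_mono_left hK _).trans (touching_mono Set.inter_subset_left))
      ((touching_mono_left hL _).trans (touching_mono Set.sdiff_subset)))
  obtain ⟨hKle, hKlt⟩ := hKD (S ∩ V(K)) Set.inter_subset_right
  obtain ⟨hLle, -⟩ := hLD (S \ V(K)) (Set.sdiff_subset_iff.2 (hS.trans hV))
  rw [← Set.encard_sdiff_add_encard_inter S V(K), add_comm (S \ V(K)).encard]
  refine ⟨(add_le_add hKle hLle).trans htouching, fun ⟨v, hvS, hvD⟩ => ?_⟩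
  rw [add_right_comm]
  exact (add_le_add (hKlt ⟨v, ⟨hvS, hD hvD⟩, hvD⟩) hLle).trans htouching

lemma Expands.union (hKD : Expands K D) (hLD : Expands L D') (hD : D ⊆ V(K)) (hD' : D' ⊆ V(L))
    (hK : K ≤ J) (hL : L ≤ J) (hV : V(J) ⊆ V(K) ∪ V(L)) : Expands J (D ∪ D') := by
  intro S hS
  obtain ⟨hle, hlt⟩ := hKD.union_left hLD hD hK hL hV S hS
  refine ⟨hle, ?_⟩
  rintro ⟨v, hvS, hvD | hvD⟩
  · exact hlt ⟨v, hvS, hvD⟩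
  · exact (hLD.union_left hKD hD' hL hK (hV.trans (Set.union_comm _ _).subset) S hS).2 ⟨v, hvS, hvD⟩

/-- Hall's theorem, the index `none` providing a second edge at `d`. -/
lemma Expands.exists_matching (h : Expands G D) (hE : E(G).Finite) {d : α} (hd : d ∈ V(G))
    (hdD : d ∈ D) :
    ∃ f : Option V(G) → β, Function.Injective f ∧ ∀ o, G.Inc (f o) (o.elim d (↑)) := by
  classical
  let t : Option V(G) → Finset β := fun o =>
    (hE.subset (G.incidenceSet_subset_edgeSet (o.elim d (↑)))).toFinset
  suffices hall : ∀ s : Finset (Option V(G)), s.card ≤ (s.biUnion t).card by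
    obtain ⟨f, hinj, hf⟩ := (Finset.all_card_le_biUnion_card_iff_exists_injective t).1 hall
    exact ⟨f, hinj, fun o => by simpa [t] using hf o⟩
  intro s
  set S : Set α := (fun o : Option V(G) => o.elim d (↑)) '' s with hS
  have hSV : S ⊆ V(G) := by
    rintro _ ⟨_ | v, -, rfl⟩
    exacts [hd, v.2]
  have htouching : touching G S = s.biUnion t := by
    ext e
    simp [touching, hS, t]
  have hsome : Set.InjOn (fun o : Option V(G) => o.elim d (↑)) (s.erase none) := by
    rintro (_ | x) hx (_ | y) hy hxy <;> simp_all [Subtype.ext_iff]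
  rw [← Nat.cast_le (α := ℕ∞), ← Set.encard_coe_eq_coe_finsetCard,
    ← Set.encard_coe_eq_coe_finsetCard, ← htouching]
  by_cases hnone : none ∈ s
  · refine le_trans ?_ ((h S hSV).2 ⟨d, ⟨none, hnone, rfl⟩, hdD⟩)
    rw [← Finset.insert_erase hnone, Finset.coe_insert]
    refine (Set.encard_insert_le _ _).trans (add_le_add_left ?_ _)
    rw [← hsome.encard_image]
    exact Set.encard_le_encard (Set.image_mono (Finset.erase_subset _ _))
  · rw [Finset.erase_eq_of_notMem hnone] at hsome
    rw [← hsome.encard_image]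
    exact (h S hSV).1

end Subgraph

section Embedding

variable {α β α' β' : Type*} {H H' : Graph α β} {G G' K : Graph α' β'} {p : α → α'} {q : β → β'}

/-- The maps `p` of vertices and `q` of edges identify `H` with a subgraph of `G`; their values
outside `H` are irrelevant. -/
structure IsEmbedding (H : Graph α β) (G : Graph α' β') (p : α → α') (q : β → β') : Prop where
  injOn_vertex : Set.InjOn p V(H)
  injOn_edge : Set.InjOn q E(H)
  mapsTo : Set.MapsTo p V(H) V(G)
  isLink : ∀ ⦃e x y⦄, H.IsLink e x y → G.IsLink (q e) (p x) (p y)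

lemma IsEmbedding.anti (h : IsEmbedding H G p q) (hle : H' ≤ H) : IsEmbedding H' G p q :=
  ⟨h.injOn_vertex.mono hle.vertexSet_mono, h.injOn_edge.mono hle.edgeSet_mono,
    h.mapsTo.mono_left hle.vertexSet_mono, fun _ _ _ hl => h.isLink (hle.isLink_mono hl)⟩

lemma IsEmbedding.mono (h : IsEmbedding H G p q) (hle : G ≤ G') : IsEmbedding H G' p q :=
  ⟨h.injOn_vertex, h.injOn_edge, h.mapsTo.mono_right hle.vertexSet_mono,
    fun _ _ _ hl => hle.isLink_mono (h.isLink hl)⟩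

lemma IsEmbedding.isLink_iff (h : IsEmbedding H G p q) {e : β} {x y : α} (he : e ∈ E(H))
    (hx : x ∈ V(H)) (hy : y ∈ V(H)) : H.IsLink e x y ↔ G.IsLink (q e) (p x) (p y) := by
  refine ⟨fun hl => h.isLink hl, fun hl => ?_⟩
  obtain ⟨a, b, hab⟩ := Graph.exists_isLink_of_mem_edgeSet he
  rcases (h.isLink hab).eq_and_eq_or_eq_and_eq hl with ⟨h1, h2⟩ | ⟨h1, h2⟩
  · rwa [← h.injOn_vertex hab.left_mem hx h1, ← h.injOn_vertex hab.right_mem hy h2]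
  · rw [← h.injOn_vertex hab.left_mem hy h1, ← h.injOn_vertex hab.right_mem hx h2]
    exact hab.symm

lemma IsEmbedding.isomorphic (h : IsEmbedding H K p q) (hp : p '' V(H) = V(K))
    (hq : q '' E(H) = E(K)) : Isomorphic K H := by
  have hp' : Set.BijOn p V(H) V(K) := hp ▸ h.injOn_vertex.bijOn_image
  have hq' : Set.BijOn q E(H) E(K) := hq ▸ h.injOn_edge.bijOn_image
  have p_symm (x : V(K)) : p (hp'.equiv.symm x) = x :=
    congrArg Subtype.val (hp'.equiv.apply_symm_apply x)
  have q_symm (e : E(K)) : q (hq'.equiv.symm e) = e :=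
    congrArg Subtype.val (hq'.equiv.apply_symm_apply e)
  refine ⟨hp'.equiv.symm, hq'.equiv.symm, fun e x y => ?_⟩
  rw [h.isLink_iff (Subtype.coe_prop _) (Subtype.coe_prop _) (Subtype.coe_prop _), p_symm, p_symm,
    q_symm]

lemma exists_bijOn_of_equiv {s : Set α} {t : Set α'} [Nonempty α'] (f : s ≃ t) :
    ∃ p : α → α', Set.BijOn p s t ∧ ∀ x : s, p x = f x := by
  obtain ⟨p, hp⟩ : ∃ p : α → α', ∀ x : s, p x = f x :=
    ⟨Function.extend (↑) (fun x => (f x : α')) fun _ => Classical.arbitrary _,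
      Subtype.val_injective.extend_apply _ _⟩
  refine ⟨p, ⟨fun x hx => ?_, fun x hx y hy hxy => ?_, fun y hy => ?_⟩, hp⟩
  · exact hp ⟨x, hx⟩ ▸ Subtype.coe_prop _
  · rw [hp ⟨x, hx⟩, hp ⟨y, hy⟩] at hxy
    simpa using Subtype.ext hxy
  · exact ⟨f.symm ⟨y, hy⟩, Subtype.coe_prop _, by rw [hp, Equiv.apply_symm_apply]⟩

lemma Isomorphic.exists_isEmbedding [Nonempty α'] [Nonempty β'] (h : Isomorphic K H) :
    ∃ p q, IsEmbedding H K p q ∧ p '' V(H) = V(K) ∧ q '' E(H) = E(K) := by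
  obtain ⟨f, g, hfg⟩ := h
  obtain ⟨p, hp, hpf⟩ := exists_bijOn_of_equiv f.symm
  obtain ⟨q, hq, hqg⟩ := exists_bijOn_of_equiv g.symm
  refine ⟨p, q, ⟨hp.injOn, hq.injOn, hp.mapsTo, fun e x y hl => ?_⟩, hp.image_eq, hq.image_eq⟩
  rw [hqg ⟨e, hl.edge_mem⟩, hpf ⟨x, hl.left_mem⟩, hpf ⟨y, hl.right_mem⟩, hfg]
  simpa using hl

lemma IsEmbedding.subgraphOn_mem_copies (h : IsEmbedding H G p q) :
    subgraphOn G (p '' V(H)) (q '' E(H)) ∈ copies H G ∧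
      E(subgraphOn G (p '' V(H)) (q '' E(H))) = q '' E(H) := by
  have hE : E(subgraphOn G (p '' V(H)) (q '' E(H))) = q '' E(H) := by
    refine edgeSet_subgraphOn ?_
    rintro _ ⟨e, he, rfl⟩
    obtain ⟨x, y, hl⟩ := Graph.exists_isLink_of_mem_edgeSet he
    exact ⟨p x, ⟨x, hl.left_mem, rfl⟩, p y, ⟨y, hl.right_mem, rfl⟩, h.isLink hl⟩
  have hle : subgraphOn G (p '' V(H)) (q '' E(H)) ≤ G := by
    refine subgraphOn_le le_rfl h.mapsTo.image_subset ?_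
    rintro _ ⟨e, he, rfl⟩
    obtain ⟨x, y, hl⟩ := Graph.exists_isLink_of_mem_edgeSet he
    exact (h.isLink hl).edge_mem
  refine ⟨⟨hle, IsEmbedding.isomorphic ⟨h.injOn_vertex, h.injOn_edge,
    Set.mapsTo_image p V(H), fun e x y hl => ?_⟩ rfl hE.symm⟩, hE⟩
  exact ⟨⟨⟨e, hl.edge_mem, rfl⟩, h.isLink hl⟩, ⟨x, hl.left_mem, rfl⟩, ⟨y, hl.right_mem, rfl⟩⟩

lemma IsEmbedding.expands_image (h : IsEmbedding H K p q) (hp : p '' V(H) = V(K)) {D : Set α}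
    (hD : D ⊆ V(H)) (hH : Expands H D) : Expands K (p '' D) := by
  intro S hS
  set S' := V(H) ∩ p ⁻¹' S
  have himage : p '' S' = S := by rw [Set.image_inter_preimage, hp, Set.inter_eq_right.2 hS]
  have hcard : S.encard = S'.encard := by
    rw [← himage, (h.injOn_vertex.mono Set.inter_subset_left).encard_image]
  have htouching : (touching H S').encard ≤ (touching K S).encard := by
    rw [← (h.injOn_edge.mono touching_subset_edgeSet).encard_image]
    refine Set.encard_le_encard ?_
    rintro _ ⟨e, ⟨v, hv, w, hl⟩, rfl⟩
    exact ⟨p v, hv.2, p w, h.isLink hl⟩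
  obtain ⟨hle, hlt⟩ := hH S' Set.inter_subset_left
  rw [hcard]
  refine ⟨hle.trans htouching, ?_⟩
  rintro ⟨_, hv, v, hvD, rfl⟩
  exact (hlt ⟨v, ⟨hD hvD, hv⟩, hvD⟩).trans htouching

end Embedding

section Probability

lemma measureReal_pi_uniformOn_forall_eq {ι : Type*} [Fintype ι] {X : ι → Type*}
    [∀ i, Fintype (X i)] [∀ i, Nonempty (X i)] [∀ i, MeasurableSpace (X i)]
    [∀ i, MeasurableSingletonClass (X i)] (s : Finset ι) (x : ∀ i, X i) :
    (Measure.pi fun i => uniformOn (Set.univ : Set (X i))).real {ω | ∀ i ∈ s, ω i = x i} =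
      ∏ i ∈ s, (Fintype.card (X i) : ℝ)⁻¹ := by
  have hpi : {ω | ∀ i ∈ s, ω i = x i} = (s : Set ι).pi fun i => {x i} := rfl
  rw [hpi, Measure.real, Measure.pi_pi_finset, ENNReal.toReal_prod]
  simp [uniformOn_univ]

variable {α β : Type*} {m n : ℕ} {ω ω' : Choices m n} {e : ℕ × ℕ × Fin m}
  {H : Graph α β} {K : Graph ℕ (ℕ × ℕ × Fin m)}

instance (p : Finset.Icc 2 n × Fin m) : Nonempty (Finset.Icc 1 ((p.1 : ℕ) - 1)) := by
  have := Finset.mem_Icc.1 p.1.2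
  exact ⟨⟨1, Finset.mem_Icc.2 ⟨le_rfl, by omega⟩⟩⟩

instance : IsProbabilityMeasure (choiceMeasure m n) := by
  unfold choiceMeasure
  infer_instance

lemma mem_edgeSet_completeMultigraph :
    e ∈ E(completeMultigraph m n) ↔ 1 ≤ e.2.1 ∧ e.2.1 < e.1 ∧ e.1 ≤ n :=
  ⟨fun ⟨_, _, h, _⟩ => h, fun h => ⟨e.1, e.2.1, h, Or.inl ⟨rfl, rfl⟩⟩⟩

lemma finite_vertexSet_completeMultigraph : V(completeMultigraph m n).Finite := Set.finite_Icc 1 n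

lemma finite_edgeSet_completeMultigraph : E(completeMultigraph m n).Finite := by
  refine ((Set.finite_Iic n).prod ((Set.finite_Iic n).prod Set.finite_univ)).subset fun e he => ?_
  obtain ⟨-, hlt, hle⟩ := mem_edgeSet_completeMultigraph.1 he
  exact ⟨hle, (hlt.trans_le hle).le, Set.mem_univ _⟩

lemma finite_edgeSet_of_le (hK : K ≤ completeMultigraph m n) : E(K).Finite :=
  finite_edgeSet_completeMultigraph.subset hK.edgeSet_mono

lemma two_le_of_mem_edgeSet (hK : K ≤ completeMultigraph m n) (he : e ∈ E(K)) : 2 ≤ e.1 := by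
  have := mem_edgeSet_completeMultigraph.1 (hK.edgeSet_mono he)
  omega

lemma finite_copies_completeMultigraph (H : Graph α β) (m n : ℕ) :
    (copies H (completeMultigraph m n)).Finite :=
  (finite_setOf_le finite_vertexSet_completeMultigraph finite_edgeSet_completeMultigraph).subset
    fun _ hK => hK.1

/-- The edge `(j, i, a)` selected by the choice `i` that the vertex `j` makes for the label `a`. -/
def chosenEdge (ω : Choices m n) (p : Finset.Icc 2 n × Fin m) : ℕ × ℕ × Fin m := (p.1, ω p, p.2)

lemma injective_chosenEdge (ω : Choices m n) : Function.Injective (chosenEdge ω) := by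
  rintro ⟨⟨j, hj⟩, a⟩ ⟨⟨j', hj'⟩, a'⟩ h
  simp only [chosenEdge, Prod.mk.injEq] at h
  obtain ⟨rfl, -, rfl⟩ := h
  rfl

lemma edgeSet_attachmentGraph (ω : Choices m n) :
    E(attachmentGraph m n ω) = Set.range (chosenEdge ω) := by
  ext e
  constructor
  · rintro ⟨-, h, hω⟩
    exact ⟨(⟨e.1, h⟩, e.2.2), by rw [chosenEdge, hω]⟩
  · rintro ⟨p, rfl⟩
    have hj := Finset.mem_Icc.1 p.1.2
    have hi := Finset.mem_Icc.1 (ω p).2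
    exact ⟨mem_edgeSet_completeMultigraph.2
      ⟨hi.1, by simp only [chosenEdge]; omega, hj.2⟩, p.1.2, rfl⟩

lemma chosenEdge_mem_edgeSet_attachmentGraph {p : Finset.Icc 2 n × Fin m} :
    chosenEdge ω p ∈ E(attachmentGraph m n ω') ↔ ω' p = ω p := by
  rw [edgeSet_attachmentGraph]
  constructor
  · rintro ⟨⟨⟨j, hj⟩, a⟩, h⟩
    obtain ⟨⟨j', hj'⟩, a'⟩ := p
    simp only [chosenEdge, Prod.mk.injEq] at h
    obtain ⟨rfl, h, rfl⟩ := h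
    exact Subtype.ext h
  · exact fun h => ⟨p, by rw [chosenEdge, chosenEdge, h]⟩

lemma attachmentGraph_le (ω : Choices m n) : attachmentGraph m n ω ≤ completeMultigraph m n :=
  Graph.restrict_le

lemma le_attachmentGraph_iff (hK : K ≤ completeMultigraph m n) :
    K ≤ attachmentGraph m n ω ↔ E(K) ⊆ E(attachmentGraph m n ω) :=
  ⟨fun h => h.edgeSet_mono, fun h => ⟨hK.vertexSet_mono, fun _ _ _ hl =>
    ((attachmentGraph_le ω).isLink_iff (h hl.edge_mem)).2 (hK.isLink_mono hl)⟩⟩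

/-- The probability that `K ⊆ K^m_n` is contained in `G^m_n`, provided that its edges do not compete
for the same choice. -/
noncomputable def weight (K : Graph ℕ (ℕ × ℕ × Fin m)) : ℝ := ∏ᶠ e ∈ E(K), ((e.1 : ℝ) - 1)⁻¹

lemma weight_pos (hK : K ≤ completeMultigraph m n) : 0 < weight K := by
  refine finprod_mem_induction (0 < ·) one_pos (fun _ _ => mul_pos) fun e he => inv_pos.2 ?_
  have : (2 : ℝ) ≤ e.1 := by exact_mod_cast two_le_of_mem_edgeSet hK he
  linarith

lemma measureReal_le_attachmentGraph (hK : K ≤ attachmentGraph m n ω) :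
    (choiceMeasure m n).real {ω | K ≤ attachmentGraph m n ω} = weight K := by
  classical
  let s : Finset (Finset.Icc 2 n × Fin m) := {p | chosenEdge ω p ∈ E(K)}
  have hKs : E(K) = chosenEdge ω '' s := by
    have hrange := hK.edgeSet_mono.trans (edgeSet_attachmentGraph ω).le
    rw [Finset.coe_filter_univ]
    exact (Set.image_preimage_eq_of_subset hrange).symm
  have hevent : {ω' | K ≤ attachmentGraph m n ω'} = {ω' | ∀ p ∈ s, ω' p = ω p} := by
    ext ω'
    rw [Set.mem_ofPred_eq, le_attachmentGraph_iff (hK.trans (attachmentGraph_le ω)), hKs,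
      Set.image_subset_iff]
    exact forall₂_congr fun p _ => chosenEdge_mem_edgeSet_attachmentGraph
  rw [hevent, choiceMeasure, measureReal_pi_uniformOn_forall_eq, weight, hKs,
    finprod_mem_image (injective_chosenEdge ω).injOn, finprod_mem_coe_finset]
  refine Finset.prod_congr rfl fun p _ => ?_
  have := Finset.mem_Icc.1 p.1.2
  simp [chosenEdge, Nat.cast_sub (show 1 ≤ (p.1 : ℕ) by omega)]

lemma measureReal_le_attachmentGraph_le (hK : K ≤ completeMultigraph m n) :
    (choiceMeasure m n).real {ω | K ≤ attachmentGraph m n ω} ≤ weight K := by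
  rcases Set.eq_empty_or_nonempty {ω : Choices m n | K ≤ attachmentGraph m n ω} with h | ⟨ω, hω⟩
  · rw [h, measureReal_empty]
    exact (weight_pos hK).le
  · exact (measureReal_le_attachmentGraph hω).le

/-- No vertex has two different edges in `F` to smaller vertices with the same label: the condition
defining potential copies. -/
def LabelInjective (F : Set (ℕ × ℕ × Fin m)) : Prop := F.InjOn fun e => (e.1, e.2.2)

lemma labelInjective_edgeSet_attachmentGraph (ω : Choices m n) :
    LabelInjective E(attachmentGraph m n ω) := by
  rw [edgeSet_attachmentGraph]
  rintro _ ⟨⟨⟨j, hj⟩, a⟩, rfl⟩ _ ⟨⟨⟨j', hj'⟩, a'⟩, rfl⟩ h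
  obtain ⟨rfl, rfl⟩ := Prod.mk.inj h
  rfl

lemma finite_potentialCopies (H : Graph α β) (m n : ℕ) : (potentialCopies H m n).Finite :=
  (finite_copies_completeMultigraph H m n).subset (Set.sep_subset _ _)

lemma mem_potentialCopies :
    K ∈ potentialCopies H m n ↔ K ∈ copies H (completeMultigraph m n) ∧ LabelInjective E(K) :=
  and_congr_right fun _ => ⟨fun h e he f hf hef => h e he f hf (Prod.mk.inj hef).1
    (Prod.mk.inj hef).2, fun h _ he _ hf h₁ h₂ => h he hf (Prod.ext h₁ h₂)⟩

lemma LabelInjective.exists_le_attachmentGraph (h : LabelInjective E(K))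
    (hK : K ≤ completeMultigraph m n) : ∃ ω, K ≤ attachmentGraph m n ω := by
  have hchoice (p : Finset.Icc 2 n × Fin m) : ∃ i : Finset.Icc 1 ((p.1 : ℕ) - 1),
      ∀ e ∈ E(K), e.1 = p.1 → e.2.2 = p.2 → (i : ℕ) = e.2.1 := by
    by_cases hp : ∃ e ∈ E(K), e.1 = p.1 ∧ e.2.2 = p.2
    · obtain ⟨e, he, h₁, h₂⟩ := hp
      obtain ⟨hpos, hlt, -⟩ := mem_edgeSet_completeMultigraph.1 (hK.edgeSet_mono he)
      refine ⟨⟨e.2.1, Finset.mem_Icc.2 ⟨hpos, by omega⟩⟩, fun f hf hf₁ hf₂ => ?_⟩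
      rw [h hf he (Prod.ext (hf₁.trans h₁.symm) (hf₂.trans h₂.symm))]
    · exact ⟨Classical.arbitrary _, fun e he h₁ h₂ => (hp ⟨e, he, h₁, h₂⟩).elim⟩
  choose ω hω using hchoice
  refine ⟨ω, (le_attachmentGraph_iff hK).2 fun e he => ?_⟩
  have hj : e.1 ∈ Finset.Icc 2 n := Finset.mem_Icc.2
    ⟨two_le_of_mem_edgeSet hK he, (mem_edgeSet_completeMultigraph.1 (hK.edgeSet_mono he)).2.2⟩
  rw [edgeSet_attachmentGraph]
  exact ⟨(⟨e.1, hj⟩, e.2.2), by rw [chosenEdge, hω _ e he rfl rfl]⟩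

end Probability

section Moments

variable {α β : Type*} (H : Graph α β) (m n : ℕ)

/-- The copies of `H` in `K^m_n` as a `Finset`, to sum over. -/
noncomputable def completeCopies : Finset (Graph ℕ (ℕ × ℕ × Fin m)) :=
  (finite_copies_completeMultigraph H m n).toFinset

variable {H m n} in
lemma mem_completeCopies {K : Graph ℕ (ℕ × ℕ × Fin m)} :
    K ∈ completeCopies H m n ↔ K ∈ copies H (completeMultigraph m n) :=
  Set.Finite.mem_toFinset _

lemma copyCount_eq_sum_indicator (ω : Choices m n) :
    copyCount H m n ω = ∑ K ∈ completeCopies H m n,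
      {ω | K ≤ attachmentGraph m n ω}.indicator (1 : Choices m n → ℝ) ω := by
  classical
  have hcopies : copies H (attachmentGraph m n ω) =
      ((completeCopies H m n).filter (· ≤ attachmentGraph m n ω) : Finset _) := by
    ext K
    simp only [Finset.coe_filter, mem_completeCopies, Set.mem_ofPred_eq, copies]
    exact ⟨fun h => ⟨⟨h.1.trans (attachmentGraph_le ω), h.2⟩, h.1⟩, fun h => ⟨h.2, h.1.2⟩⟩
  rw [copyCount, hcopies, Set.ncard_coe_finset, Finset.card_filter, Nat.cast_sum]
  simp [Set.indicator_apply]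

lemma integral_copyCount :
    ∫ ω, copyCount H m n ω ∂(choiceMeasure m n) =
      ∑ K ∈ completeCopies H m n, (choiceMeasure m n).real {ω | K ≤ attachmentGraph m n ω} := by
  simp_rw [copyCount_eq_sum_indicator]
  rw [integral_finsetSum _ fun _ _ => Integrable.of_finite]
  exact Finset.sum_congr rfl fun K _ => integral_indicator_one (Set.toFinite _).measurableSet

lemma integral_copyCount_sq :
    ∫ ω, copyCount H m n ω ^ 2 ∂(choiceMeasure m n) =
      ∑ P ∈ completeCopies H m n ×ˢ completeCopies H m n, (choiceMeasure m n).real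
        {ω | P.1 ≤ attachmentGraph m n ω ∧ P.2 ≤ attachmentGraph m n ω} := by
  simp_rw [copyCount_eq_sum_indicator, sq, Finset.sum_mul_sum, ← Finset.sum_product']
  rw [integral_finsetSum _ fun _ _ => Integrable.of_finite]
  refine Finset.sum_congr rfl fun P _ => ?_
  rw [← integral_indicator_one (Set.toFinite _).measurableSet]
  exact integral_congr_ae (.of_forall fun ω => (congrFun Set.inter_indicator_one ω).symm)

lemma variance_copyCount_le :
    variance (copyCount H m n) (choiceMeasure m n) ≤
      ∫ ω, copyCount H m n ω ^ 2 ∂(choiceMeasure m n) :=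
  variance_le_expectation_sq AEStronglyMeasurable.of_discrete

lemma sq_integral_copyCount_le :
    (∫ ω, copyCount H m n ω ∂(choiceMeasure m n)) ^ 2 ≤
      ∫ ω, copyCount H m n ω ^ 2 ∂(choiceMeasure m n) := by
  have hvar : variance (copyCount H m n) (choiceMeasure m n) = _ := variance_eq_sub .of_discrete
  exact sub_nonneg.1 (hvar ▸ variance_nonneg _ _)

lemma integral_copyCount_eq_sum_weight :
    ∫ ω, copyCount H m n ω ∂(choiceMeasure m n) =
      ∑ K ∈ (finite_potentialCopies H m n).toFinset, weight K := by
  rw [integral_copyCount]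
  refine (Finset.sum_subset (fun K hK => ?_) fun K hK hK' => ?_).symm.trans
    (Finset.sum_congr rfl fun K hK => ?_)
  · exact mem_completeCopies.2 ((Set.Finite.mem_toFinset _).1 hK).1
  · rw [Set.Finite.mem_toFinset, mem_potentialCopies, ← mem_completeCopies] at hK'
    have hempty : {ω : Choices m n | K ≤ attachmentGraph m n ω} = ∅ :=
      Set.eq_empty_of_forall_notMem fun ω hω =>
        hK' ⟨hK, (labelInjective_edgeSet_attachmentGraph ω).mono hω.edgeSet_mono⟩
    rw [hempty, measureReal_empty]
  · obtain ⟨hcopy, hlabel⟩ := mem_potentialCopies.1 ((Set.Finite.mem_toFinset _).1 hK)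
    obtain ⟨ω, hω⟩ := hlabel.exists_le_attachmentGraph hcopy.1
    exact measureReal_le_attachmentGraph hω

end Moments

section WeightBound

variable {m n : ℕ} {K J : Graph ℕ (ℕ × ℕ × Fin m)} {e : ℕ × ℕ × Fin m} {v : ℕ}

lemma inv_sub_one_le_of_inc (hK : K ≤ completeMultigraph m n) (h : K.Inc e v) :
    ((e.1 : ℝ) - 1)⁻¹ ≤ 2 * (v : ℝ)⁻¹ := by
  have hv1 : 1 ≤ v := (hK.vertexSet_mono h.vertex_mem).1
  have hve : v ≤ e.1 := by
    obtain ⟨w, ⟨-, hlt, -⟩, hend⟩ := h.mono hK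
    omega
  have he2 : (2 : ℝ) ≤ e.1 := by exact_mod_cast two_le_of_mem_edgeSet hK h.edge_mem
  have hv1' : (1 : ℝ) ≤ v := by exact_mod_cast hv1
  have hve' : (v : ℝ) ≤ e.1 := by exact_mod_cast hve
  rw [← div_eq_mul_inv, inv_eq_one_div, div_le_div_iff₀ (by linarith) (by linarith)]
  linarith

lemma weight_le_finprod (hJ : J ≤ completeMultigraph m n) {D : Set ℕ} (h : Expands J D) {d : ℕ}
    (hd : d ∈ V(J)) (hdD : d ∈ D) :
    weight J ≤ 2 * (d : ℝ)⁻¹ * ∏ᶠ v ∈ V(J), 2 * (v : ℝ)⁻¹ := by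
  have hfin := finite_edgeSet_of_le hJ
  have : Finite V(J) := finite_vertexSet_completeMultigraph.subset hJ.vertexSet_mono
  have := Fintype.ofFinite V(J)
  have hfactor : ∀ e ∈ E(J), 0 ≤ ((e.1 : ℝ) - 1)⁻¹ ∧ ((e.1 : ℝ) - 1)⁻¹ ≤ 1 := fun e he => by
    have : (2 : ℝ) ≤ e.1 := by exact_mod_cast two_le_of_mem_edgeSet hJ he
    exact ⟨inv_nonneg.2 (by linarith), inv_le_one_of_one_le₀ (by linarith)⟩
  have hprod : ∀ F ⊆ E(J), 0 ≤ ∏ᶠ e ∈ F, ((e.1 : ℝ) - 1)⁻¹ ∧ ∏ᶠ e ∈ F, ((e.1 : ℝ) - 1)⁻¹ ≤ 1 :=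
    fun F hF => finprod_mem_induction (fun x => 0 ≤ x ∧ x ≤ 1) ⟨zero_le_one, le_rfl⟩
      (fun _ _ hx hy => ⟨mul_nonneg hx.1 hy.1, mul_le_one₀ hx.2 hy.1 hy.2⟩)
      fun e he => hfactor e (hF he)
  obtain ⟨f, hinj, hf⟩ := h.exists_matching hfin hd hdD
  have hrange : Set.range f ⊆ E(J) := Set.range_subset_iff.2 fun o => (hf o).edge_mem
  calc weight J
      = (∏ᶠ e ∈ Set.range f, ((e.1 : ℝ) - 1)⁻¹) * ∏ᶠ e ∈ E(J) \ Set.range f, ((e.1 : ℝ) - 1)⁻¹ :=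
        (finprod_mem_mul_sdiff hrange hfin).symm
    _ ≤ ∏ᶠ e ∈ Set.range f, ((e.1 : ℝ) - 1)⁻¹ := by
        exact mul_le_of_le_one_right (hprod _ hrange).1 (hprod _ Set.sdiff_subset).2
    _ = ∏ o, (((f o).1 : ℝ) - 1)⁻¹ := by
        rw [finprod_mem_range hinj, finprod_eq_prod_of_fintype]
    _ ≤ ∏ o : Option V(J), 2 * (o.elim (d : ℝ) (↑))⁻¹ := by
        refine Finset.prod_le_prod (fun o _ => (hfactor _ (hf o).edge_mem).1) fun o _ => ?_
        cases o <;> exact inv_sub_one_le_of_inc hJ (hf _)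
    _ = 2 * (d : ℝ)⁻¹ * ∏ᶠ v ∈ V(J), 2 * (v : ℝ)⁻¹ := by
        rw [Fintype.prod_option, ← finprod_set_coe_eq_finprod_mem, finprod_eq_prod_of_fintype]
        rfl

lemma inv_le_prod_rpow {ε : ℝ} (hε : 0 ≤ ε) (C : Finset ℕ) (hεC : ε * C.card ≤ 1) {d : ℕ}
    (hC : ∀ v ∈ C, 1 ≤ v ∧ v ≤ d) (hd : 1 ≤ d) : (d : ℝ)⁻¹ ≤ ∏ v ∈ C, (v : ℝ) ^ (-ε) := by
  have hd' : (1 : ℝ) ≤ d := by exact_mod_cast hd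
  calc (d : ℝ)⁻¹ = (d : ℝ) ^ (-1 : ℝ) := (Real.rpow_neg_one _).symm
    _ ≤ (d : ℝ) ^ (-ε * C.card) := Real.rpow_le_rpow_of_exponent_le hd' (by linarith)
    _ = ∏ _v ∈ C, (d : ℝ) ^ (-ε) := by
        rw [Finset.prod_const, Real.rpow_mul_natCast (by positivity)]
    _ ≤ ∏ v ∈ C, (v : ℝ) ^ (-ε) := by
        refine Finset.prod_le_prod (fun v _ => by positivity) fun v hv => ?_
        obtain ⟨hv1, hvd⟩ := hC v hv
        exact Real.rpow_le_rpow_of_nonpos (by exact_mod_cast hv1) (by exact_mod_cast hvd)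
          (by linarith)

lemma weight_le_of_expands (hJ : J ≤ completeMultigraph m n) {C A : Finset ℕ}
    (hCA : Disjoint C A) (hV : V(J) = ↑(C ∪ A)) (hC : C.Nonempty) (hexp : Expands J ↑C) {ε : ℝ}
    (hε : 0 ≤ ε) (hεC : ε * C.card ≤ 1) :
    weight J ≤ 2 ^ (C.card + A.card + 1) *
      ((∏ v ∈ C, (v : ℝ) ^ (-(1 + ε))) * ∏ v ∈ A, (v : ℝ)⁻¹) := by
  have hpos : ∀ v ∈ C ∪ A, 1 ≤ v := fun v hv =>
    (hJ.vertexSet_mono (hV ▸ Finset.mem_coe.2 hv)).1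
  have hmax := Finset.mem_union_left A (C.max'_mem hC)
  have hsplit : ∏ v ∈ C, (v : ℝ) ^ (-(1 + ε)) =
      (∏ v ∈ C, (v : ℝ) ^ (-ε)) * ∏ v ∈ C, (v : ℝ)⁻¹ := by
    rw [← Finset.prod_mul_distrib]
    refine Finset.prod_congr rfl fun v hv => ?_
    have : (0 : ℝ) < v := by exact_mod_cast hpos v (Finset.mem_union_left A hv)
    rw [← Real.rpow_neg_one, ← Real.rpow_add this, neg_add_rev]
  calc weight J ≤ 2 * ((C.max' hC : ℕ) : ℝ)⁻¹ * ∏ᶠ v ∈ V(J), 2 * (v : ℝ)⁻¹ :=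
        weight_le_finprod hJ hexp (hV ▸ Finset.mem_coe.2 hmax) (C.max'_mem hC)
    _ = 2 ^ (C.card + A.card + 1) *
          (((C.max' hC : ℕ) : ℝ)⁻¹ * ((∏ v ∈ C, (v : ℝ)⁻¹) * ∏ v ∈ A, (v : ℝ)⁻¹)) := by
        rw [hV, finprod_mem_coe_finset, Finset.prod_mul_distrib, Finset.prod_const,
          Finset.prod_union hCA, Finset.card_union_of_disjoint hCA]
        ring
    _ ≤ _ := by
        rw [hsplit, mul_assoc (∏ v ∈ C, _)]
        gcongr
        exact inv_le_prod_rpow hε C hεC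
          (fun v hv => ⟨hpos v (Finset.mem_union_left A hv), C.le_max' v hv⟩) (hpos _ hmax)

end WeightBound

section Sums

lemma sum_powerset_prod_rpow_le {ε : ℝ} (hε : 0 < ε) (s : Finset ℕ) :
    ∑ C ∈ s.powerset, ∏ v ∈ C, (v : ℝ) ^ (-(1 + ε)) ≤
      Real.exp (∑' v : ℕ, (v : ℝ) ^ (-(1 + ε))) := by
  have hs : Summable fun v : ℕ => (v : ℝ) ^ (-(1 + ε)) :=
    Real.summable_nat_rpow.2 (by linarith)
  rw [← Finset.prod_one_add]
  refine (Real.prod_one_add_le_exp_sum _ fun v => by positivity).trans (Real.exp_le_exp.2 ?_)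
  exact hs.sum_le_tsum _ fun v _ => by positivity

lemma sum_filter_card_le_prod_le {ι : Type*} (s : Finset ι) {x : ι → ℝ} (hx : ∀ i, 0 ≤ x i) {L : ℝ}
    (hL : 1 ≤ L) (hsum : ∑ i ∈ s, x i ≤ L) (t : ℕ) :
    ∑ A ∈ s.powerset.filter (fun A => A.card ≤ t), ∏ i ∈ A, x i ≤ Real.exp 1 * L ^ t := by
  have hL0 : 0 < L := by linarith
  calc ∑ A ∈ s.powerset.filter (fun A => A.card ≤ t), ∏ i ∈ A, x i
      ≤ ∑ A ∈ s.powerset.filter (fun A => A.card ≤ t), L ^ t * ∏ i ∈ A, x i / L := by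
        refine Finset.sum_le_sum fun A hA => ?_
        rw [Finset.prod_div_distrib, Finset.prod_const, mul_div_left_comm]
        refine le_mul_of_one_le_right (Finset.prod_nonneg fun i _ => hx i) ?_
        exact (one_le_div (by positivity)).2 (pow_le_pow_right₀ hL (Finset.mem_filter.1 hA).2)
    _ ≤ ∑ A ∈ s.powerset, L ^ t * ∏ i ∈ A, x i / L :=
        Finset.sum_le_sum_of_subset_of_nonneg (Finset.filter_subset _ _) fun A _ _ =>
          mul_nonneg (by positivity) (Finset.prod_nonneg fun i _ => div_nonneg (hx i) hL0.le)
    _ = L ^ t * ∏ i ∈ s, (1 + x i / L) := by rw [← Finset.mul_sum, ← Finset.prod_one_add]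
    _ ≤ L ^ t * Real.exp (∑ i ∈ s, x i / L) := by
        gcongr
        exact Real.prod_one_add_le_exp_sum _ fun i => div_nonneg (hx i) hL0.le
    _ ≤ L ^ t * Real.exp 1 := by
        gcongr
        rwa [← Finset.sum_div, div_le_one hL0]
    _ = Real.exp 1 * L ^ t := mul_comm _ _

lemma sum_Icc_inv_le_one_add_log (n : ℕ) : ∑ v ∈ Finset.Icc 1 n, (v : ℝ)⁻¹ ≤ 1 + Real.log n := by
  have h := harmonic_le_one_add_log n
  rw [harmonic_eq_sum_Icc] at h
  push_cast at h
  exact h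

lemma sum_le_mul_sum_of_card_filter_le {ι κ : Type*} {I : Finset ι} {T : Finset κ}
    (r : ι → κ → Prop) [∀ i k, Decidable (r i k)] {w : ι → ℝ} {g : κ → ℝ} {M : ℕ}
    (hg : ∀ k ∈ T, 0 ≤ g k) (hw : ∀ i ∈ I, ∃ k ∈ T, r i k ∧ w i ≤ g k)
    (hM : ∀ k ∈ T, (I.filter fun i => r i k).card ≤ M) :
    ∑ i ∈ I, w i ≤ M * ∑ k ∈ T, g k := by
  calc ∑ i ∈ I, w i ≤ ∑ i ∈ I, ∑ k ∈ T with r i k, g k := by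
        refine Finset.sum_le_sum fun i hi => ?_
        obtain ⟨k, hk, hr, hwg⟩ := hw i hi
        exact hwg.trans (Finset.single_le_sum (fun k hk => hg k (Finset.mem_filter.1 hk).1)
          (Finset.mem_filter.2 ⟨hk, hr⟩))
    _ = ∑ k ∈ T, ∑ i ∈ I with r i k, g k :=
        Finset.sum_sum_bipartiteAbove_eq_sum_sum_bipartiteBelow r fun _ k => g k
    _ ≤ ∑ k ∈ T, M * g k := by
        refine Finset.sum_le_sum fun k hk => ?_
        rw [Finset.sum_const, nsmul_eq_mul]
        exact mul_le_mul_of_nonneg_right (by exact_mod_cast hM k hk) (hg k hk)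
    _ = M * ∑ k ∈ T, g k := (Finset.mul_sum _ _ _).symm

end Sums

section SecondMoment

variable {α β : Type*} {H : Graph α β} {m n : ℕ} {K L : Graph ℕ (ℕ × ℕ × Fin m)} {D : Set α}

lemma Isomorphic.ncard_vertexSet_eq {α' β' : Type*} {G : Graph α' β'} (h : Isomorphic G H) :
    V(G).ncard = V(H).ncard :=
  let ⟨f, _⟩ := h
  Nat.card_congr f

lemma exists_expands_of_mem_copies [NeZero m] (hK : K ∈ copies H (completeMultigraph m n))
    (hD : D ⊆ V(H)) (hexp : Expands H D) :
    ∃ D' ⊆ V(K), D'.ncard = D.ncard ∧ (V(K) \ D').ncard = (V(H) \ D).ncard ∧ Expands K D' := by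
  obtain ⟨p, q, h, hp, -⟩ := hK.2.exists_isEmbedding
  refine ⟨p '' D, hp ▸ Set.image_mono hD, (h.injOn_vertex.mono hD).ncard_image, ?_,
    h.expands_image hp hD hexp⟩
  rw [← hp, ← h.injOn_vertex.image_sdiff_subset hD]
  exact (h.injOn_vertex.mono Set.sdiff_subset).ncard_image

lemma exists_expands_of_mem_copies_of_mem_copies [NeZero m]
    (hK : K ∈ copies H (completeMultigraph m n)) (hL : L ∈ copies H (completeMultigraph m n))
    (hD : D ⊆ V(H)) (hne : D.Nonempty) (hVfin : V(H).Finite) (hexp : Expands H D) :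
    ∃ C A : Finset ℕ, Disjoint C A ∧ V(K) ∪ V(L) = ↑(C ∪ A) ∧ C.Nonempty ∧
      C.card ≤ 2 * D.ncard ∧ A.card ≤ 2 * (V(H) \ D).ncard ∧
      ∀ J, K ≤ J → L ≤ J → V(J) = ↑(C ∪ A) → Expands J ↑C := by
  classical
  obtain ⟨D₁, hD₁, hcard₁, hcompl₁, hexp₁⟩ := exists_expands_of_mem_copies hK hD hexp
  obtain ⟨D₂, hD₂, hcard₂, hcompl₂, hexp₂⟩ := exists_expands_of_mem_copies hL hD hexp
  have hKfin := finite_vertexSet_completeMultigraph.subset hK.1.vertexSet_mono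
  have hLfin := finite_vertexSet_completeMultigraph.subset hL.1.vertexSet_mono
  obtain ⟨C, hC⟩ := ((hKfin.subset hD₁).union (hLfin.subset hD₂)).exists_finset_coe
  obtain ⟨A, hA⟩ := ((hKfin.union hLfin).sdiff (t := D₁ ∪ D₂)).exists_finset_coe
  have hV : V(K) ∪ V(L) = ↑(C ∪ A) := by
    rw [Finset.coe_union, hC, hA, Set.union_sdiff_cancel (Set.union_subset_union hD₁ hD₂)]
  refine ⟨C, A, ?_, hV, ?_, ?_, ?_, fun J hKJ hLJ hJ => ?_⟩
  · rw [← Finset.disjoint_coe, hC, hA]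
    exact Set.disjoint_sdiff_right
  · have : D₁.Nonempty := Set.nonempty_of_ncard_ne_zero
      (hcard₁ ▸ (hne.ncard_pos (hVfin.subset hD)).ne')
    exact Finset.coe_nonempty.1 (hC ▸ this.inl)
  · rw [← Set.ncard_coe_finset, hC]
    refine (Set.ncard_union_le _ _).trans ?_
    omega
  · have hsub : (V(K) ∪ V(L)) \ (D₁ ∪ D₂) ⊆ (V(K) \ D₁) ∪ (V(L) \ D₂) := by
      rintro v ⟨hv | hv, hv'⟩
      exacts [.inl ⟨hv, fun h => hv' (.inl h)⟩, .inr ⟨hv, fun h => hv' (.inr h)⟩]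
    rw [← Set.ncard_coe_finset, hA]
    refine (Set.ncard_le_ncard hsub (hKfin.sdiff.union hLfin.sdiff)).trans ?_
    refine (Set.ncard_union_le _ _).trans ?_
    omega
  · rw [hC]
    exact hexp₁.union hexp₂ hD₁ hD₂ hKJ hLJ (hJ.trans hV.symm).subset

lemma exists_le_measureReal_le_weight (hK : K ≤ completeMultigraph m n)
    (hL : L ≤ completeMultigraph m n) :
    ∃ J ≤ completeMultigraph m n, K ≤ J ∧ L ≤ J ∧ V(J) = V(K) ∪ V(L) ∧
      (choiceMeasure m n).real {ω | K ≤ attachmentGraph m n ω ∧ L ≤ attachmentGraph m n ω} ≤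
        weight J := by
  have hsup {G : Graph ℕ (ℕ × ℕ × Fin m)} (hG : G ≤ completeMultigraph m n) (hKG : K ≤ G)
      (hLG : L ≤ G) : subgraphOn (completeMultigraph m n) (V(K) ∪ V(L)) (E(K) ∪ E(L)) ≤ G :=
    subgraphOn_le hG (Set.union_subset hKG.vertexSet_mono hLG.vertexSet_mono)
      (Set.union_subset hKG.edgeSet_mono hLG.edgeSet_mono)
  refine ⟨_, hsup le_rfl hK hL, le_subgraphOn hK Set.subset_union_left Set.subset_union_left,
    le_subgraphOn hL Set.subset_union_right Set.subset_union_right, rfl, ?_⟩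
  refine le_trans ?_ (measureReal_le_attachmentGraph_le (hsup le_rfl hK hL))
  exact measureReal_mono fun ω hω => hsup (attachmentGraph_le ω) hω.1 hω.2

lemma exists_measureReal_le_prod [NeZero m] (hK : K ∈ copies H (completeMultigraph m n))
    (hL : L ∈ copies H (completeMultigraph m n)) (hD : D ⊆ V(H)) (hne : D.Nonempty)
    (hVfin : V(H).Finite) (hexp : Expands H D) {ε : ℝ} (hε : 0 ≤ ε)
    (hεD : ε * (2 * D.ncard : ℕ) ≤ 1) :
    ∃ C ⊆ Finset.Icc 1 n, ∃ A ⊆ Finset.Icc 1 n, A.card ≤ 2 * (V(H) \ D).ncard ∧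
      V(K) ∪ V(L) = ↑(C ∪ A) ∧
      (choiceMeasure m n).real {ω | K ≤ attachmentGraph m n ω ∧ L ≤ attachmentGraph m n ω} ≤
        2 ^ (2 * D.ncard + 2 * (V(H) \ D).ncard + 1) *
          ((∏ v ∈ C, (v : ℝ) ^ (-(1 + ε))) * ∏ v ∈ A, (v : ℝ)⁻¹) := by
  obtain ⟨C, A, hCA, hV, hC, hCcard, hAcard, hJexp⟩ :=
    exists_expands_of_mem_copies_of_mem_copies hK hL hD hne hVfin hexp
  obtain ⟨J, hJ, hKJ, hLJ, hVJ, hprob⟩ := exists_le_measureReal_le_weight hK.1 hL.1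
  rw [hV] at hVJ
  have hsub : C ∪ A ⊆ Finset.Icc 1 n := by
    rw [← Finset.coe_subset, ← hVJ, Finset.coe_Icc]
    exact hJ.vertexSet_mono
  have hεC : ε * C.card ≤ 1 := le_trans (by gcongr) hεD
  refine ⟨C, Finset.union_subset_left hsub, A, Finset.union_subset_right hsub, hAcard, hV,
    hprob.trans ((weight_le_of_expands hJ hCA hVJ hC (hJexp J hKJ hLJ hVJ) hε hεC).trans ?_)⟩
  gcongr
  norm_num

lemma ncard_setOf_vertexSet_subset_le (X : Finset ℕ) :
    {K | K ≤ completeMultigraph m n ∧ V(K) ⊆ X}.ncard ≤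
      2 ^ X.card * 2 ^ (X.card * (X.card * m)) := by
  let G := (completeMultigraph m n).induce X
  have hE : E(G) ⊆ ↑(X ×ˢ X ×ˢ (Finset.univ : Finset (Fin m))) := by
    rintro e ⟨x, y, ⟨-, hend⟩, hx, hy⟩
    obtain ⟨rfl, rfl⟩ | ⟨rfl, rfl⟩ := hend <;> simp_all
  have hVfin : V(G).Finite := X.finite_toSet
  have hEfin : E(G).Finite := (Finset.finite_toSet _).subset hE
  have hEcard : E(G).ncard ≤ X.card * (X.card * m) := by
    refine (Set.ncard_le_ncard hE (Finset.finite_toSet _)).trans_eq ?_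
    simp only [Set.ncard_coe_finset, Finset.card_product, Finset.card_univ, Fintype.card_fin]
  calc {K | K ≤ completeMultigraph m n ∧ V(K) ⊆ X}.ncard
      ≤ {K | K ≤ G}.ncard := Set.ncard_le_ncard (fun K hK => ⟨hK.2, fun _ _ _ h =>
        ⟨hK.1.isLink_mono h, hK.2 h.left_mem, hK.2 h.right_mem⟩⟩) (finite_setOf_le hVfin hEfin)
    _ ≤ 2 ^ V(G).ncard * 2 ^ E(G).ncard := ncard_setOf_le_le hVfin hEfin
    _ ≤ 2 ^ X.card * 2 ^ (X.card * (X.card * m)) := by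
        rw [show V(G).ncard = X.card from Set.ncard_coe_finset X]
        gcongr
        norm_num

open Classical in
lemma exists_card_filter_completeCopies_le (H : Graph α β) (m : ℕ) :
    ∃ M : ℕ, ∀ (n : ℕ) (X : Finset ℕ), ((completeCopies H m n ×ˢ completeCopies H m n).filter
      fun P => V(P.1) ∪ V(P.2) = X).card ≤ M := by
  set N := 2 * V(H).ncard
  refine ⟨(2 ^ N * 2 ^ (N * (N * m))) ^ 2, fun n X => ?_⟩
  obtain h | ⟨P, hP⟩ := Finset.eq_empty_or_nonempty
    ((completeCopies H m n ×ˢ completeCopies H m n).filter fun P => V(P.1) ∪ V(P.2) = X)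
  · simp [h]
  have hX : X.card ≤ N := by
    simp only [Finset.mem_filter, Finset.mem_product, mem_completeCopies] at hP
    rw [← Set.ncard_coe_finset, ← hP.2]
    refine (Set.ncard_union_le _ _).trans ?_
    rw [hP.1.1.2.ncard_vertexSet_eq, hP.1.2.2.ncard_vertexSet_eq]
    omega
  set 𝒢 := {K | K ≤ completeMultigraph m n ∧ V(K) ⊆ X}
  have hfin : 𝒢.Finite := (finite_setOf_le finite_vertexSet_completeMultigraph
    finite_edgeSet_completeMultigraph).subset fun _ hK => hK.1
  calc _ ≤ (𝒢 ×ˢ 𝒢).ncard := by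
        rw [← Set.ncard_coe_finset]
        refine Set.ncard_le_ncard (fun P hP => ?_) (hfin.prod hfin)
        simp only [Finset.coe_filter, Finset.mem_product, mem_completeCopies] at hP
        obtain ⟨⟨hK, hL⟩, hV⟩ := hP
        exact ⟨⟨hK.1, hV ▸ Set.subset_union_left⟩, hL.1, hV ▸ Set.subset_union_right⟩
    _ = 𝒢.ncard ^ 2 := by rw [Set.ncard_prod, sq]
    _ ≤ (2 ^ X.card * 2 ^ (X.card * (X.card * m))) ^ 2 := by
        gcongr
        exact ncard_setOf_vertexSet_subset_le X
    _ ≤ (2 ^ N * 2 ^ (N * (N * m))) ^ 2 := by gcongr <;> norm_num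

lemma exists_integral_copyCount_sq_le [NeZero m] (hD : D ⊆ V(H)) (hne : D.Nonempty)
    (hVfin : V(H).Finite) (hexp : Expands H D) :
    ∃ B : ℝ, ∀ n : ℕ, ∫ ω, copyCount H m n ω ^ 2 ∂(choiceMeasure m n) ≤
      B * (1 + Real.log n) ^ (2 * (V(H) \ D).ncard) := by
  classical
  obtain ⟨M, hM⟩ := exists_card_filter_completeCopies_le H m
  set k := D.ncard
  set t := (V(H) \ D).ncard
  have hk : 0 < k := hne.ncard_pos (hVfin.subset hD)
  obtain ⟨ε, hε, hεk⟩ : ∃ ε : ℝ, 0 < ε ∧ ε * (2 * k : ℕ) ≤ 1 :=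
    ⟨((2 * k : ℕ) : ℝ)⁻¹, by positivity, (inv_mul_cancel₀ (by positivity)).le⟩
  set Z := Real.exp (∑' v : ℕ, (v : ℝ) ^ (-(1 + ε)))
  let Q : ℝ := 2 ^ (2 * k + 2 * t + 1)
  refine ⟨M * (Q * (Z * Real.exp 1)), fun n => ?_⟩
  let 𝒯 := (Finset.Icc 1 n).powerset ×ˢ (Finset.Icc 1 n).powerset.filter fun A => A.card ≤ 2 * t
  rw [integral_copyCount_sq]
  calc _ ≤ M * ∑ T ∈ 𝒯, Q * ((∏ v ∈ T.1, (v : ℝ) ^ (-(1 + ε))) * ∏ v ∈ T.2, (v : ℝ)⁻¹) := by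
        refine sum_le_mul_sum_of_card_filter_le
          (fun P T => V(P.1) ∪ V(P.2) = ((T.1 ∪ T.2 : Finset ℕ) : Set ℕ))
          (fun T _ => by positivity) (fun P hP => ?_) fun T _ => hM n _
        simp only [Finset.mem_product, mem_completeCopies] at hP
        obtain ⟨C, hC, A, hA, hAcard, hV, hprob⟩ :=
          exists_measureReal_le_prod hP.1 hP.2 hD hne hVfin hexp hε.le hεk
        refine ⟨(C, A), ?_, hV, hprob⟩
        simp only [𝒯, Finset.mem_product, Finset.mem_powerset, Finset.mem_filter]
        exact ⟨hC, hA, hAcard⟩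
    _ = M * (Q * ((∑ C ∈ (Finset.Icc 1 n).powerset, ∏ v ∈ C, (v : ℝ) ^ (-(1 + ε))) *
          ∑ A ∈ (Finset.Icc 1 n).powerset.filter fun A => A.card ≤ 2 * t, ∏ v ∈ A, (v : ℝ)⁻¹)) := by
        rw [Finset.sum_mul_sum, ← Finset.sum_product', ← Finset.mul_sum]
    _ ≤ M * (Q * (Z * (Real.exp 1 * (1 + Real.log n) ^ (2 * t)))) := by
        gcongr
        · exact sum_powerset_prod_rpow_le hε _
        · exact sum_filter_card_le_prod_le _ (fun v => by positivity)
            (by linarith [Real.log_natCast_nonneg n]) (sum_Icc_inv_le_one_add_log n) _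
    _ = _ := by ring

end SecondMoment

section Leaf

variable {α β : Type*} {H : Graph α β} {D : Set α} {v u : α} {e : β}

/-- The vertex `v` is a leaf of `H`, joined to its neighbour `u` by the edge `e`. -/
structure IsLeaf (H : Graph α β) (v u : α) (e : β) : Prop where
  isLink : H.IsLink e v u
  ne : u ≠ v
  eq_of_inc : ∀ ⦃f⦄, H.Inc f v → f = e

lemma Expands.exists_isLeaf (h : Expands H D) (hmin : ¬ MinDegreeTwo H) :
    ∃ v ∈ V(H) \ D, ∃ u e, IsLeaf H v u e := by
  obtain ⟨v, hv, hdeg⟩ : ∃ v ∈ V(H), degree H v < 2 := by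
    simpa only [MinDegreeTwo, not_forall, not_le, exists_prop] using hmin
  have htouching : touching H {v} = H.incidenceSet v := by
    ext f
    simp [touching]
  obtain ⟨hle, hlt⟩ := h {v} (Set.singleton_subset_iff.2 hv)
  rw [htouching, Set.encard_singleton] at hle hlt
  have hcard : (H.incidenceSet v).encard = 1 :=
    (Order.le_of_lt_add_one ((le_self_add.trans_lt hdeg).trans_eq one_add_one_eq_two.symm)).antisymm
      hle
  have hvD : v ∉ D := fun hvD => absurd (hlt ⟨v, rfl, hvD⟩) (by rw [hcard]; norm_num)
  obtain ⟨e, he⟩ := Set.encard_eq_one.1 hcard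
  obtain ⟨u, hlink⟩ : H.Inc e v := he.ge rfl
  refine ⟨v, ⟨hv, hvD⟩, u, e, hlink, ?_, fun f hf => he.le hf⟩
  rintro rfl
  refine hdeg.not_ge ?_
  rw [degree, hcard, ← one_add_one_eq_two]
  exact add_le_add_right (Set.one_le_encard_iff_nonempty.2 ⟨e, hlink⟩) 1

lemma IsLeaf.edgeSet_eq (h : IsLeaf H v u e) : E(H) = insert e E(H.deleteVerts {v}) := by
  refine subset_antisymm (fun f hf => ?_)
    (Set.insert_subset h.isLink.edge_mem Graph.deleteVerts_le.edgeSet_mono)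
  obtain ⟨x, y, hl⟩ := Graph.exists_isLink_of_mem_edgeSet hf
  by_cases hfe : f = e
  · exact Or.inl hfe
  · refine Or.inr ⟨x, y, (H.deleteVerts_isLink {v}).2 ⟨hl, ?_, ?_⟩⟩
    · rintro rfl
      exact hfe (h.eq_of_inc hl.inc_left)
    · rintro rfl
      exact hfe (h.eq_of_inc hl.inc_right)

lemma IsLeaf.notMem_edgeSet (h : IsLeaf H v u e) : e ∉ E(H.deleteVerts {v}) := by
  rintro ⟨x, y, hl⟩
  obtain ⟨hl, hx, hy⟩ := (H.deleteVerts_isLink {v}).1 hl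
  rcases h.isLink.inc_left.eq_or_eq_of_isLink hl with rfl | rfl
  exacts [hx rfl, hy rfl]

lemma IsLeaf.vertexSet_eq (h : IsLeaf H v u e) : V(H) = insert v V(H.deleteVerts {v}) := by
  rw [Graph.vertexSet_deleteVerts, Set.insert_sdiff_singleton,
    Set.insert_eq_of_mem h.isLink.left_mem]

lemma IsLeaf.expands_deleteVerts (h : IsLeaf H v u e) (hH : Expands H D) (hv : v ∉ D) :
    Expands (H.deleteVerts {v}) D := by
  intro S hS
  rw [Graph.vertexSet_deleteVerts] at hS
  have hvS : v ∉ S := fun hv => (hS hv).2 rfl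
  have htouching : touching H (insert v S) ⊆ insert e (touching (H.deleteVerts {v}) S) := by
    rintro f ⟨w, hw, hinc⟩
    have hf := h.edgeSet_eq.le hinc.edge_mem
    rcases hf with hf | hf
    · exact Or.inl hf
    · refine Or.inr ⟨w, hw.resolve_left ?_, (Graph.deleteVerts_le.inc_congr hf).2 hinc⟩
      rintro rfl
      exact h.notMem_edgeSet (h.eq_of_inc hinc ▸ hf)
  have hcard := (Set.encard_le_encard htouching).trans (Set.encard_insert_le _ _)
  obtain ⟨hle, hlt⟩ := hH (insert v S)
    (Set.insert_subset h.isLink.left_mem (hS.trans Set.sdiff_subset))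
  rw [Set.encard_insert_of_notMem hvS] at hle hlt
  refine ⟨ENat.add_le_add_iff_right ENat.one_ne_top |>.1 (hle.trans hcard), fun hSD => ?_⟩
  exact ENat.add_le_add_iff_right ENat.one_ne_top |>.1
    ((hlt (hSD.mono (Set.inter_subset_inter_left _ (Set.subset_insert v S)))).trans hcard)

end Leaf

section Extension

variable {α β γ δ : Type*} {H : Graph α β} {G : Graph γ δ} {v u : α} {e : β} {p : α → γ}
  {q : β → δ} {x : γ} {f : δ}

lemma image_update_insert [DecidableEq α] {s : Set α} (hv : v ∉ s) :
    Function.update p v x '' insert v s = insert x (p '' s) := by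
  rw [Set.image_insert_eq, Function.update_self, Set.image_congr fun w hw =>
    Function.update_of_ne (ne_of_mem_of_not_mem hw hv) _ _]

lemma injOn_update_insert [DecidableEq α] {s : Set α} (hp : s.InjOn p) (hv : v ∉ s)
    (hx : x ∉ p '' s) : (insert v s).InjOn (Function.update p v x) := by
  have heq : s.EqOn p (Function.update p v x) := fun w hw =>
    (Function.update_of_ne (ne_of_mem_of_not_mem hw hv) _ _).symm
  rw [Set.injOn_insert hv, Function.update_self, ← heq.image_eq]
  exact ⟨hp.congr heq, hx⟩

lemma IsLeaf.isEmbedding_update [DecidableEq α] [DecidableEq β] (h : IsLeaf H v u e)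
    (hpq : IsEmbedding (H.deleteVerts {v}) G p q) (hf : G.IsLink f x (p u))
    (hx : x ∉ p '' V(H.deleteVerts {v})) (hfq : f ∉ q '' E(H.deleteVerts {v})) :
    IsEmbedding H G (Function.update p v x) (Function.update q e f) := by
  have hv : v ∉ V(H.deleteVerts {v}) := by simp
  refine ⟨?_, ?_, ?_, fun g a b hl => ?_⟩
  · exact h.vertexSet_eq ▸ injOn_update_insert hpq.injOn_vertex hv hx
  · exact h.edgeSet_eq ▸ injOn_update_insert hpq.injOn_edge h.notMem_edgeSet hfq
  · rw [Set.mapsTo_iff_image_subset, h.vertexSet_eq, image_update_insert hv]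
    exact Set.insert_subset hf.left_mem hpq.mapsTo.image_subset
  · by_cases hg : g = e
    · subst hg
      rcases hl.eq_and_eq_or_eq_and_eq h.isLink with ⟨rfl, rfl⟩ | ⟨rfl, rfl⟩
      · simpa [Function.update_of_ne h.ne] using hf
      · simpa [Function.update_of_ne h.ne] using hf.symm
    · have ha : a ≠ v := fun ha => hg (h.eq_of_inc (ha ▸ hl.inc_left))
      have hb : b ≠ v := fun hb => hg (h.eq_of_inc (hb ▸ hl.inc_right))
      rw [Function.update_of_ne hg, Function.update_of_ne ha, Function.update_of_ne hb]
      exact hpq.isLink ((H.deleteVerts_isLink {v}).2 ⟨hl, ha, hb⟩)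

end Extension

section PotentialCopies

variable {α β : Type*} {H H' : Graph α β} {m m' n n' x : ℕ} {K : Graph ℕ (ℕ × ℕ × Fin m)}
  {v u : α} {e : β}

lemma completeMultigraph_mono (hn : n ≤ n') : completeMultigraph m n ≤ completeMultigraph m n' :=
  ⟨Set.Icc_subset_Icc_right hn, fun _ _ _ ⟨⟨hpos, hlt, hle⟩, hends⟩ =>
    ⟨⟨hpos, hlt, hle.trans hn⟩, hends⟩⟩

lemma notMem_vertexSet_of_lt (hK : K ≤ completeMultigraph m n) (hx : n < x) : x ∉ V(K) :=
  fun h => hx.not_ge (hK.vertexSet_mono h).2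

lemma notMem_edgeSet_of_lt {i : ℕ} {a : Fin m} (hK : K ≤ completeMultigraph m n) (hx : n < x) :
    (x, i, a) ∉ E(K) :=
  fun h => hx.not_ge (mem_edgeSet_completeMultigraph.1 (hK.edgeSet_mono h)).2.2

lemma potentialCopies_mono (hn : n ≤ n') : potentialCopies H m n ⊆ potentialCopies H m n' :=
  fun _ hK => ⟨⟨hK.1.1.trans (completeMultigraph_mono hn), hK.1.2⟩, hK.2⟩

lemma potentialCopies_nonempty_iff [NeZero m] : (potentialCopies H m n).Nonempty ↔
    ∃ p q, IsEmbedding H (completeMultigraph m n) p q ∧ LabelInjective (q '' E(H)) := by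
  constructor
  · rintro ⟨K, hK⟩
    obtain ⟨⟨hle, hiso⟩, hlabel⟩ := mem_potentialCopies.1 hK
    obtain ⟨p, q, hpq, -, hq⟩ := hiso.exists_isEmbedding
    exact ⟨p, q, hpq.mono hle, hq ▸ hlabel⟩
  · rintro ⟨p, q, hpq, hlabel⟩
    obtain ⟨hcopy, hE⟩ := hpq.subgraphOn_mem_copies
    exact ⟨_, mem_potentialCopies.2 ⟨hcopy, hE.symm ▸ hlabel⟩⟩

lemma potentialCopies_nonempty_of_le [NeZero m] (hle : H' ≤ H)
    (h : (potentialCopies H m n).Nonempty) : (potentialCopies H' m n).Nonempty := by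
  obtain ⟨p, q, hpq, hlabel⟩ := potentialCopies_nonempty_iff.1 h
  exact potentialCopies_nonempty_iff.2
    ⟨p, q, hpq.anti hle, hlabel.mono (Set.image_mono hle.edgeSet_mono)⟩

lemma potentialCopies_nonempty_of_label_le [NeZero m] (hm : m ≤ m')
    (h : (potentialCopies H m n).Nonempty) : (potentialCopies H m' n).Nonempty := by
  have : NeZero m' := ⟨((NeZero.pos m).trans_le hm).ne'⟩
  obtain ⟨p, q, hpq, hlabel⟩ := potentialCopies_nonempty_iff.1 h
  have hkey : E(H).InjOn fun e => ((q e).1, Fin.castLE hm (q e).2.2) := by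
    intro e he f hf hef
    obtain ⟨hfst, hlab⟩ := Prod.mk.inj hef
    exact hpq.injOn_edge he hf (hlabel ⟨e, he, rfl⟩ ⟨f, hf, rfl⟩
      (Prod.ext hfst (Fin.castLE_injective hm hlab)))
  refine potentialCopies_nonempty_iff.2
    ⟨p, fun e => ((q e).1, (q e).2.1, Fin.castLE hm (q e).2.2), ⟨hpq.injOn_vertex, ?_,
      hpq.mapsTo, fun _ _ _ hl => hpq.isLink hl⟩, hkey.image_of_comp⟩
  exact fun e he f hf hef => hkey he hf (by simp_all)

lemma exists_potentialCopies_nonempty [H.Loopless] (hV : V(H).Finite) (hE : E(H).Finite) :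
    ∃ m, 1 ≤ m ∧ ∃ n, (potentialCopies H m n).Nonempty := by
  obtain ⟨p, hpV, hp⟩ := hV.exists_injOn_of_encard_le (t := Set.Icc 1 V(H).ncard) (by
    simp [← hV.cast_ncard_eq, Set.encard_coe_eq_coe_finsetCard, ← Finset.coe_Icc])
  obtain ⟨l, -, hl⟩ := hE.exists_injOn_of_encard_le
    (t := (Set.univ : Set (Fin (E(H).ncard + 1)))) (by simp [← hE.cast_ncard_eq])
  have hedge (e : β) : ∃ f : ℕ × ℕ × Fin (E(H).ncard + 1), f.2.2 = l e ∧ ∀ x y, H.IsLink e x y →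
      (completeMultigraph _ V(H).ncard).IsLink f (p x) (p y) := by
    by_cases he : e ∈ E(H)
    · obtain ⟨x, y, hl⟩ := Graph.exists_isLink_of_mem_edgeSet he
      obtain ⟨hx, hxn⟩ := hpV hl.left_mem
      obtain ⟨hy, hyn⟩ := hpV hl.right_mem
      have hne : p x ≠ p y := fun h => hl.ne (hp hl.left_mem hl.right_mem h)
      refine ⟨(max (p x) (p y), min (p x) (p y), l e), rfl, fun x' y' hl' => ?_⟩
      rcases hl.eq_and_eq_or_eq_and_eq hl' with ⟨rfl, rfl⟩ | ⟨rfl, rfl⟩ <;>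
        exact ⟨by simp only; omega, by simp only; omega⟩
    · exact ⟨(0, 0, l e), rfl, fun x y hl => absurd hl.edge_mem he⟩
  choose q hql hq using hedge
  refine ⟨_, Nat.succ_pos _, _, potentialCopies_nonempty_iff.2 ⟨p, q, ⟨hp, ?_, hpV, hq⟩, ?_⟩⟩
  · exact fun e he f hf hef => hl he hf (by rw [← hql, ← hql, hef])
  · rintro _ ⟨e, he, rfl⟩ _ ⟨f, hf, rfl⟩ hef
    rw [hl he hf (by rw [← hql, ← hql, (Prod.mk.inj hef).2])]

lemma exists_potentialCopies_nonempty_of_minLabels_le [H.Loopless] (hV : V(H).Finite)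
    (hE : E(H).Finite) (hm : minLabels H ≤ m) : ∃ n, (potentialCopies H m n).Nonempty := by
  obtain ⟨hpos, n, hne⟩ : 1 ≤ minLabels H ∧ ∃ n, (potentialCopies H (minLabels H) n).Nonempty :=
    Nat.sInf_mem (exists_potentialCopies_nonempty hV hE)
  have : NeZero (minLabels H) := ⟨by omega⟩
  exact ⟨n, potentialCopies_nonempty_of_label_le hm hne⟩

lemma IsLeaf.exists_mem_potentialCopies [NeZero m] (h : IsLeaf H v u e)
    (hK : K ∈ potentialCopies (H.deleteVerts {v}) m n) (hx : n < x) (hx' : x ≤ n') :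
    ∃ K' ∈ potentialCopies H m n', V(K') = insert x V(K) ∧
      ∃ i, E(K') = insert (x, i, 0) E(K) := by
  classical
  obtain ⟨⟨hle, hiso⟩, hlabel⟩ := mem_potentialCopies.1 hK
  obtain ⟨p, q, hpq, hp, hq⟩ := hiso.exists_isEmbedding
  have hu : p u ∈ V(K) := hpq.mapsTo (by simpa using ⟨h.isLink.right_mem, h.ne⟩)
  have hun : p u ∈ Set.Icc 1 n := hle.vertexSet_mono hu
  have hnew : (x, p u, 0) ∉ E(K) := notMem_edgeSet_of_lt hle hx
  have hlink : (completeMultigraph m n').IsLink (x, p u, 0) x (p u) :=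
    ⟨⟨hun.1, hun.2.trans_lt hx, hx'⟩, Or.inl ⟨rfl, rfl⟩⟩
  have hemb := h.isEmbedding_update (hpq.mono (hle.trans (completeMultigraph_mono
    (hx.le.trans hx')))) hlink (hp ▸ notMem_vertexSet_of_lt hle hx) (hq ▸ hnew)
  have hE : Function.update q e (x, p u, 0) '' E(H) = insert (x, p u, 0) E(K) := by
    rw [h.edgeSet_eq, image_update_insert h.notMem_edgeSet, hq]
  obtain ⟨hcopy, hE'⟩ := hemb.subgraphOn_mem_copies
  rw [hE] at hE'
  refine ⟨_, mem_potentialCopies.2 ⟨hcopy, ?_⟩, ?_, p u, hE ▸ hE'⟩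
  · rw [hE, hE', LabelInjective, Set.injOn_insert hnew]
    refine ⟨hlabel, ?_⟩
    rintro ⟨⟨y, i, a⟩, hf, hfx⟩
    obtain rfl : y = x := (Prod.mk.inj hfx).1
    exact notMem_edgeSet_of_lt hle hx hf
  · change _ '' V(H) = _
    rw [h.vertexSet_eq, image_update_insert (by simp), hp]

end PotentialCopies

section LowerBound

variable {α β : Type*} {H : Graph α β} {m n n' N b : ℕ} {D : Set α}
  {v u : α} {e : β}

lemma log_sub_log_le_sum_Ioc (hN : 1 ≤ N) (hNn : N ≤ n) :
    Real.log n - Real.log N ≤ ∑ x ∈ Finset.Ioc N n, ((x : ℝ) - 1)⁻¹ := by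
  induction n, hNn using Nat.le_induction with
  | base => simp
  | succ n hn ih =>
    have hn0 : (0 : ℝ) < n := by exact_mod_cast hN.trans hn
    have hstep := Real.log_le_sub_one_of_pos (show (0 : ℝ) < (n + 1 : ℕ) / n by positivity)
    rw [Real.log_div (by positivity) hn0.ne', div_sub_one hn0.ne', Nat.cast_succ,
      add_sub_cancel_left, one_div] at hstep
    rw [Finset.sum_Ioc_succ_top hn, Nat.cast_succ, add_sub_cancel_right]
    linarith

lemma integral_copyCount_nonneg (H : Graph α β) (m n : ℕ) :
    0 ≤ ∫ ω, copyCount H m n ω ∂(choiceMeasure m n) :=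
  integral_nonneg fun _ => Nat.cast_nonneg _

lemma integral_copyCount_pos (h : (potentialCopies H m n).Nonempty) :
    0 < ∫ ω, copyCount H m n ω ∂(choiceMeasure m n) := by
  rw [integral_copyCount_eq_sum_weight]
  refine Finset.sum_pos (fun K hK => ?_) ((Set.Finite.toFinset_nonempty _).2 h)
  exact weight_pos ((Set.Finite.mem_toFinset _).1 hK).1.1

lemma integral_copyCount_mono (hn : n ≤ n') :
    ∫ ω, copyCount H m n ω ∂(choiceMeasure m n) ≤
      ∫ ω, copyCount H m n' ω ∂(choiceMeasure m n') := by
  rw [integral_copyCount_eq_sum_weight, integral_copyCount_eq_sum_weight]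
  exact Finset.sum_le_sum_of_subset_of_nonneg (Set.Finite.toFinset_mono (potentialCopies_mono hn))
    fun K hK _ => (weight_pos ((Set.Finite.mem_toFinset _).1 hK).1.1).le

lemma eq_and_eq_of_insert_eq_insert {γ : Type*} {a b : γ} {s t : Set γ}
    (h : insert a s = insert b t) (has : a ∉ s) (hat : a ∉ t) : a = b ∧ s = t := by
  obtain rfl : a = b := (h.le (Set.mem_insert a s)).resolve_right hat
  refine ⟨rfl, ?_⟩
  rw [← Set.insert_sdiff_self_of_notMem has, h, Set.insert_sdiff_self_of_notMem hat]

lemma IsLeaf.sum_mul_integral_copyCount_le [NeZero m] (h : IsLeaf H v u e) (n n' : ℕ) :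
    (∑ x ∈ Finset.Ioc n n', ((x : ℝ) - 1)⁻¹) *
        ∫ ω, copyCount (H.deleteVerts {v}) m n ω ∂(choiceMeasure m n) ≤
      ∫ ω, copyCount H m n' ω ∂(choiceMeasure m n') := by
  classical
  set 𝒦 := (finite_potentialCopies (H.deleteVerts {v}) m n).toFinset
  have hlt : ∀ P ∈ Finset.Ioc n n' ×ˢ 𝒦, n < P.1 := fun P hP =>
    (Finset.mem_Ioc.1 (Finset.mem_product.1 hP).1).1
  have hle : ∀ P ∈ Finset.Ioc n n' ×ˢ 𝒦, P.2 ≤ completeMultigraph m n := fun P hP =>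
    ((Set.Finite.mem_toFinset _).1 (Finset.mem_product.1 hP).2).1.1
  have hextend : ∀ P ∈ Finset.Ioc n n' ×ˢ 𝒦, ∃ K' ∈ potentialCopies H m n',
      V(K') = insert P.1 V(P.2) ∧ ∃ i, E(K') = insert (P.1, i, 0) E(P.2) := by
    intro P hP
    obtain ⟨hx, hK⟩ := Finset.mem_product.1 hP
    exact h.exists_mem_potentialCopies ((Set.Finite.mem_toFinset _).1 hK) (hlt P hP)
      (Finset.mem_Ioc.1 hx).2
  choose! Φ hΦ hV i hE using hextend
  have hweight : ∀ P ∈ Finset.Ioc n n' ×ˢ 𝒦, weight (Φ P) = ((P.1 : ℝ) - 1)⁻¹ * weight P.2 := by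
    intro P hP
    rw [weight, hE P hP, finprod_mem_insert _ (notMem_edgeSet_of_lt (hle P hP) (hlt P hP))
      (finite_edgeSet_of_le (hle P hP)), weight]
  have hinj : Set.InjOn Φ ↑(Finset.Ioc n n' ×ˢ 𝒦) := by
    intro P hP Q hQ hPQ
    obtain ⟨hx, hVK⟩ := eq_and_eq_of_insert_eq_insert
      ((hV P hP).symm.trans (hPQ ▸ hV Q hQ)) (notMem_vertexSet_of_lt (hle P hP) (hlt P hP))
      (notMem_vertexSet_of_lt (hle Q hQ) (hlt P hP))
    obtain ⟨-, hEK⟩ := eq_and_eq_of_insert_eq_insert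
      ((hE P hP).symm.trans (hPQ ▸ hE Q hQ)) (notMem_edgeSet_of_lt (hle P hP) (hlt P hP))
      (notMem_edgeSet_of_lt (hle Q hQ) (hlt P hP))
    exact Prod.ext hx (injOn_vertexSet_edgeSet _ (hle P hP) (hle Q hQ) (Prod.ext hVK hEK))
  rw [integral_copyCount_eq_sum_weight, integral_copyCount_eq_sum_weight, Finset.sum_mul_sum,
    ← Finset.sum_product', ← Finset.sum_congr rfl hweight, ← Finset.sum_image hinj]
  refine Finset.sum_le_sum_of_subset_of_nonneg (Finset.image_subset_iff.2 fun P hP =>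
    (Set.Finite.mem_toFinset _).2 (hΦ P hP)) fun K hK _ => ?_
  exact (weight_pos ((Set.Finite.mem_toFinset _).1 hK).1.1).le

lemma IsLeaf.log_mul_integral_copyCount_le [NeZero m] (h : IsLeaf H v u e) (hN : 1 ≤ N)
    (hb : 1 ≤ b) :
    Real.log b * ∫ ω, copyCount (H.deleteVerts {v}) m N ω ∂(choiceMeasure m N) ≤
      ∫ ω, copyCount H m (N * b) ω ∂(choiceMeasure m (N * b)) := by
  refine le_trans ?_ (h.sum_mul_integral_copyCount_le N (N * b))
  refine mul_le_mul_of_nonneg_right ?_ (integral_copyCount_nonneg _ _ _)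
  have hlog := log_sub_log_le_sum_Ioc hN (Nat.le_mul_of_pos_right N hb)
  rwa [Nat.cast_mul, Real.log_mul (by positivity) (by positivity), add_sub_cancel_left] at hlog

lemma exists_mul_log_pow_le_integral_copyCount [NeZero m] (hexp : Expands H D)
    (hcore : ∀ K ≤ H, MinDegreeTwo K → V(K) ⊆ D) (hN : 1 ≤ N)
    (hne : (potentialCopies H m N).Nonempty) :
    ∃ c > 0, ∀ b : ℕ, 1 ≤ b → c * Real.log b ^ (V(H) \ D).ncard ≤
      ∫ ω, copyCount H m (N * b ^ (V(H) \ D).ncard) ω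
        ∂(choiceMeasure m (N * b ^ (V(H) \ D).ncard)) := by
  induction ht : (V(H) \ D).ncard generalizing H with
  | zero => exact ⟨_, integral_copyCount_pos hne, fun b _ => by
      rw [pow_zero, mul_one]
      exact integral_copyCount_mono (by simp)⟩
  | succ t ih =>
    have hmin : ¬ MinDegreeTwo H := fun hmin => by
      rw [Set.sdiff_eq_empty.2 (hcore H le_rfl hmin), Set.ncard_empty] at ht
      omega
    obtain ⟨v, hv, u, e, hleaf⟩ := hexp.exists_isLeaf hmin
    have hle : H.deleteVerts {v} ≤ H := Graph.deleteVerts_le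
    have ht' : (V(H.deleteVerts {v}) \ D).ncard = t := by
      rw [Graph.vertexSet_deleteVerts, sdiff_right_comm, Set.ncard_sdiff_singleton_of_mem hv, ht,
        Nat.add_sub_cancel]
    obtain ⟨c, hc, hlow⟩ := ih (hleaf.expands_deleteVerts hexp hv.2)
      (fun K hK => hcore K (hK.trans hle))
      (potentialCopies_nonempty_of_le hle hne) ht'
    refine ⟨c, hc, fun b hb => ?_⟩
    calc c * Real.log b ^ (t + 1) = Real.log b * (c * Real.log b ^ t) := by ring
      _ ≤ _ := mul_le_mul_of_nonneg_left (hlow b hb) (Real.log_natCast_nonneg b)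
      _ ≤ _ := hleaf.log_mul_integral_copyCount_le (Nat.mul_pos hN (pow_pos hb t)) hb
      _ = _ := by rw [mul_assoc, ← pow_succ]

end LowerBound

section Asymptotics

open Filter Asymptotics

variable {α β : Type*} {H : Graph α β} {D : Set α} {m N : ℕ}

lemma eventually_exists_mul_pow_le (t N : ℕ) : ∀ᶠ n : ℕ in atTop,
    ∃ b : ℕ, 1 ≤ b ∧ N * b ^ t ≤ n ∧ Real.log n ≤ 2 * (t + 1) * Real.log b := by
  have hroot : Tendsto (fun n : ℕ => (n : ℝ) ^ (1 / (t + 1) : ℝ)) atTop atTop :=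
    (tendsto_rpow_atTop (by positivity)).comp tendsto_natCast_atTop_atTop
  filter_upwards [hroot.eventually_ge_atTop (max 4 N)] with n hn
  set x := (n : ℝ) ^ (1 / (t + 1) : ℝ) with hx
  have hx4 : 4 ≤ x := (le_max_left _ _).trans hn
  have hpow : x ^ (t + 1) = n := by
    rw [hx, ← Real.rpow_natCast, ← Real.rpow_mul (Nat.cast_nonneg n), Nat.cast_succ,
      one_div_mul_cancel (by positivity), Real.rpow_one]
  have hfloor : (⌊x⌋₊ : ℝ) ≤ x := Nat.floor_le (by linarith)
  have hfloor' : x < ⌊x⌋₊ + 1 := Nat.lt_floor_add_one x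
  refine ⟨⌊x⌋₊, Nat.le_floor (by norm_num; linarith), ?_, ?_⟩
  · have hle : (⌊x⌋₊ : ℝ) ^ (t + 1) ≤ n := hpow ▸ pow_le_pow_left₀ (by positivity) hfloor _
    calc N * ⌊x⌋₊ ^ t ≤ ⌊x⌋₊ * ⌊x⌋₊ ^ t :=
          Nat.mul_le_mul_right _ (Nat.le_floor ((le_max_right _ _).trans hn))
      _ = ⌊x⌋₊ ^ (t + 1) := (pow_succ' _ _).symm
      _ ≤ n := by exact_mod_cast hle
  · have hlog : Real.log x ≤ 2 * Real.log ⌊x⌋₊ := by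
      rw [← Nat.cast_two, ← Real.log_pow]
      exact Real.log_le_log (by linarith) (by nlinarith)
    calc Real.log n = (t + 1) * Real.log x := by rw [← hpow, Real.log_pow, Nat.cast_succ]
      _ ≤ (t + 1) * (2 * Real.log ⌊x⌋₊) := mul_le_mul_of_nonneg_left hlog (by positivity)
      _ = 2 * (t + 1) * Real.log ⌊x⌋₊ := by ring

lemma one_add_log_isBigO_log :
    (fun n : ℕ => 1 + Real.log n) =O[atTop] fun n : ℕ => Real.log n := by
  refine IsBigO.add ?_ (isBigO_refl _ _)
  exact ((isLittleO_const_id_atTop 1).comp_tendsto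
    (Real.tendsto_log_atTop.comp tendsto_natCast_atTop_atTop)).isBigO

lemma integral_copyCount_sq_isBigO [NeZero m] (hD : D ⊆ V(H)) (hne : D.Nonempty)
    (hV : V(H).Finite) (hexp : Expands H D) :
    (fun n : ℕ => ∫ ω, copyCount H m n ω ^ 2 ∂(choiceMeasure m n)) =O[atTop]
      fun n : ℕ => Real.log n ^ (2 * (V(H) \ D).ncard) := by
  obtain ⟨B, hB⟩ := exists_integral_copyCount_sq_le (m := m) hD hne hV hexp
  refine IsBigO.trans (IsBigO.of_bound B (Eventually.of_forall fun n => ?_))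
    (one_add_log_isBigO_log.pow _)
  rw [Real.norm_of_nonneg (integral_nonneg fun _ => sq_nonneg _),
    Real.norm_of_nonneg (Even.pow_nonneg (even_two_mul _) _)]
  exact hB n

lemma integral_copyCount_isBigO [NeZero m] (hD : D ⊆ V(H)) (hne : D.Nonempty)
    (hV : V(H).Finite) (hexp : Expands H D) :
    (fun n : ℕ => ∫ ω, copyCount H m n ω ∂(choiceMeasure m n)) =O[atTop]
      fun n : ℕ => Real.log n ^ (V(H) \ D).ncard := by
  have hsq : (fun n : ℕ => (∫ ω, copyCount H m n ω ∂(choiceMeasure m n)) ^ 2) =O[atTop]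
      fun n : ℕ => (Real.log n ^ (V(H) \ D).ncard) ^ 2 := by
    simp only [← pow_mul, mul_comm _ 2]
    refine IsBigO.trans (IsBigO.of_norm_le fun n => ?_)
      (integral_copyCount_sq_isBigO (m := m) hD hne hV hexp)
    rw [Real.norm_of_nonneg (sq_nonneg _)]
    exact sq_integral_copyCount_le H m n
  exact hsq.of_pow two_ne_zero

lemma variance_copyCount_isBigO [NeZero m] (hD : D ⊆ V(H)) (hne : D.Nonempty)
    (hV : V(H).Finite) (hexp : Expands H D) :
    (fun n : ℕ => variance (copyCount H m n) (choiceMeasure m n)) =O[atTop]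
      fun n : ℕ => Real.log n ^ (2 * (V(H) \ D).ncard) := by
  refine IsBigO.trans (IsBigO.of_norm_le fun n => ?_)
    (integral_copyCount_sq_isBigO (m := m) hD hne hV hexp)
  rw [Real.norm_of_nonneg (variance_nonneg _ _)]
  exact variance_copyCount_le H m n

lemma log_pow_isBigO_integral_copyCount [NeZero m] (hexp : Expands H D)
    (hcore : ∀ K ≤ H, MinDegreeTwo K → V(K) ⊆ D)
    (hne : (potentialCopies H m N).Nonempty) :
    (fun n : ℕ => Real.log n ^ (V(H) \ D).ncard) =O[atTop]
      fun n : ℕ => ∫ ω, copyCount H m n ω ∂(choiceMeasure m n) := by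
  set t := (V(H) \ D).ncard
  obtain ⟨c, hc, hlow⟩ := exists_mul_log_pow_le_integral_copyCount hexp hcore
    (le_max_right N 1) (hne.mono (potentialCopies_mono (le_max_left N 1)))
  refine IsBigO.of_bound ((2 * (t + 1)) ^ t * c⁻¹) ?_
  filter_upwards [eventually_exists_mul_pow_le t (max N 1)] with n ⟨b, hb, hbn, hlog⟩
  rw [Real.norm_of_nonneg (pow_nonneg (Real.log_natCast_nonneg n) t),
    Real.norm_of_nonneg (integral_copyCount_nonneg H m n)]
  calc Real.log n ^ t ≤ (2 * (t + 1) * Real.log b) ^ t :=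
        pow_le_pow_left₀ (Real.log_natCast_nonneg n) hlog t
    _ = (2 * (t + 1)) ^ t * c⁻¹ * (c * Real.log b ^ t) := by
        rw [mul_pow]
        field_simp
    _ ≤ _ := mul_le_mul_of_nonneg_left ((hlow b hb).trans (integral_copyCount_mono hbn))
        (by positivity)

end Asymptotics

end UniformAttachment

theorem theorem3p7 {α β : Type*} (H : Graph α β) (hV : V(H).Finite) (hE : E(H).Finite)
    (hloop : H.Loopless) (hconn : UniformAttachment.IsConnected H)
    (hmulti : UniformAttachment.IsMulticyclic H)
    (m : ℕ) (hm : 1 ≤ m) (hmH : UniformAttachment.minLabels H ≤ m)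
    (t : ℕ) (ht : t = (V(H) \ V(UniformAttachment.twoCore H)).ncard) :
    (fun n : ℕ => ∫ ω, UniformAttachment.copyCount H m n ω
        ∂(UniformAttachment.choiceMeasure m n))
      =Θ[Filter.atTop] (fun n : ℕ => Real.log n ^ t) ∧
    (fun n : ℕ => ProbabilityTheory.variance (UniformAttachment.copyCount H m n)
        (UniformAttachment.choiceMeasure m n))
      =O[Filter.atTop] (fun n : ℕ => Real.log n ^ (2 * t)) := by
  have : NeZero m := ⟨by omega⟩
  have hcore : V(UniformAttachment.twoCore H) ⊆ V(H) :=
    (UniformAttachment.twoCore_le H).vertexSet_mono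
  have hne := hmulti.vertexSet_twoCore_nonempty
  have hexp := hmulti.expands_twoCore hconn hV
  obtain ⟨N, hN⟩ := UniformAttachment.exists_potentialCopies_nonempty_of_minLabels_le hV hE hmH
  subst ht
  refine ⟨⟨UniformAttachment.integral_copyCount_isBigO hcore hne hV hexp, ?_⟩,
    UniformAttachment.variance_copyCount_isBigO hcore hne hV hexp⟩
  exact UniformAttachment.log_pow_isBigO_integral_copyCount hexp
    (fun K hK hK' => (hK'.le_twoCore hK).vertexSet_mono) hN
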